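/- Let $0<q<1$, let $t\in\mathbb R$ with $|t|>1$, and let $\theta\in\mathbb R$. Let $A_q(SU(1,1))$ be the unital complex algebra generated by $\alpha,\beta,\gamma,\delta$ with relations $\alpha\beta=q\beta\alpha$, $\alpha\gamma=q\gamma\alpha$, $\beta\delta=q\delta\beta$, $\gamma\delta=q\delta\gamma$, $\beta\gamma=\gamma\beta$, $\alpha\delta-q\beta\gamma=\delta\alpha-q^{-1}\beta\gamma=1$ (with $\alpha^*=\delta$, $\gamma^*=q^{-1}\beta$), and let $\pi_{e^{i\theta}}$ be its representation on the finite linear combinations of the standard basis vectors $e_k$ ($k\in\mathbb Z$) of $\ell^2(\mathbb Z)$ given by $$\pi_{e^{i\theta}}(\alpha)e_k=\sqrt{1+q^{-2k}}\,e_{k+1},\quad \pi_{e^{i\theta}}(\gamma)e_k=e^{i\theta}q^{-k}e_k,\quad \pi_{e^{i\theta}}(\delta)e_k=\sqrt{1+q^{2-2k}}\,e_{k-1},\quad \pi_{e^{i\theta}}(\beta)e_k=q\,e^{-i\theta}q^{-k}e_k .$$ Put $$\alpha_{\infty,t}=q^{1/2}\alpha+q^{-1/2}t\beta,\quad \beta_{\infty,t}=q^{1/2}t\alpha+q^{-1/2}\beta,\quad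 \gamma_{\infty,t}=q^{1/2}\gamma+q^{-1/2}t\delta,\quad \delta_{\infty,t}=q^{1/2}t\gamma+q^{-1/2}\delta,$$ and $\mathcal D(Q)=\{\sum_k c_ke_k\in\ell^2(\mathbb Z)\mid\sum_k|c_k|^2q^{-2k}<\infty\}$. For $x,s\in\mathbb R\setminus\{0\}$ with $|s|>q$ and $k\in\mathbb Z$ let $$V_k(x;s)=(-q^{2-2k};q^2)_\infty^{1/2}\,q^{\frac12k(k+1)}(-s)^{-k}\,{}_1\varphi_1\bigl(-(xs)^{-1};q^2s^{-2};q^2,xq^{2k+2}s^{-1}\bigr),$$ where $(a;q)_n=\prod_{i=0}^{n-1}(1-aq^i)$ for $n\in\mathbb Z_{\ge0}\cup\{\infty\}$ and ${}_1\varphi_1(a;b;q,z)=\sum_{n\ge0}\frac{(a;q)_n}{(q;q)_n(b;q)_n}(-1)^nq^{n(n-1)/2}z^n$, and let $$v^\theta_p(s)=\sum_{k\in\mathbb Z}e^{ik\theta}V_k(-q^{2p}s^{-1};s)\,e_k\ (p\in\mathbb Z_{\ge0}),\qquad w^\theta_p(s)=\sum_{k\in\mathbb Z}e^{ik\theta}V_k(q^{2p}s;s)\,e_k\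 (p\in\mathbb Z).$$ Then $v^\theta_p(s),w^\theta_p(s)\in\ell^2(\mathbb Z)$ whenever $s\in\mathbb R$, $|s|>q$. For each $a\in\{\alpha_{\infty,t},\beta_{\infty,t},\gamma_{\infty,t},\delta_{\infty,t}\}$ the operator $\pi_{e^{i\theta}}(a)$ is defined on $\mathcal D(Q)$ by the same formula, that is, $\pi_{e^{i\theta}}(a)\sum_kc_ke_k=\sum_kc_k\,\pi_{e^{i\theta}}(a)e_k$ with convergence in $\ell^2(\mathbb Z)$. The vectors $v^\theta_p(t)$ $(p\in\mathbb Z_{\ge0})$ and $w^\theta_p(t)$ $(p\in\mathbb Z)$ lie in $\mathcal D(Q)$, and, for all $p\in\mathbb Z_{\ge0}$ in the formulas for $v$ and all $p\in\mathbb Z$ in the formulas for $w$, $$\begin{aligned} \pi_{e^{i\theta}}(\alpha_{\infty,t})v^\theta_p(t)&=q^{1/2}e^{-i\theta}t^{-1}\frac{1-q^{2p}}{1-q^2t^{-2}}\,v^\theta_{p-1}(tq^{-1}),& \pi_{e^{i\theta}}(\alpha_{\infty,t})w^\theta_p(t)&=q^{1/2}e^{-i\theta}t^{-1}\frac{1+t^2q^{2p}}{1-q^2t^{-2}}\,w^\theta_p(tq^{-1}),\\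 \pi_{e^{i\theta}}(\beta_{\infty,t})v^\theta_p(t)&=-t^2q^{1/2}e^{-i\theta}(1-t^{-2})\,v^\theta_p(tq),& \pi_{e^{i\theta}}(\beta_{\infty,t})w^\theta_p(t)&=-t^2q^{1/2}e^{-i\theta}(1-t^{-2})\,w^\theta_{p-1}(tq),\\ \pi_{e^{i\theta}}(\gamma_{\infty,t})v^\theta_p(t)&=-q^{1/2}e^{i\theta}\frac{1-q^{2+2p}t^{-2}}{1-q^2t^{-2}}\,v^\theta_p(tq^{-1}),& \pi_{e^{i\theta}}(\gamma_{\infty,t})w^\theta_p(t)&=-q^{1/2}e^{i\theta}\frac{1+q^{2+2p}}{1-q^2t^{-2}}\,w^\theta_{p+1}(tq^{-1}),\\ \pi_{e^{i\theta}}(\delta_{\infty,t})v^\theta_p(t)&=e^{i\theta}tq^{1/2}(1-t^{-2})\,v^\theta_{p+1}(tq),& \pi_{e^{i\theta}}(\delta_{\infty,t})w^\theta_p(t)&=e^{i\theta}tq^{1/2}(1-t^{-2})\,w^\theta_p(tq), \end{aligned}$$ where for $p=0$ the right-hand side of the first formula is $0$. -/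

import Mathlib

noncomputable section

namespace QSU11

/-! ### `q`-shifted factorials and the basic hypergeometric series `₁φ₁` -/

/-- `(a; q)_n = ∏_{i < n} (1 - a q^i)`. -/
def qPoch (a q : ℝ) (n : ℕ) : ℝ := ∏ i ∈ Finset.range n, (1 - a * q ^ i)

/-- `(a; q)_∞ = ∏_{i ≥ 0} (1 - a q^i)`. -/
def qPochInf (a q : ℝ) : ℝ := ∏' i : ℕ, (1 - a * q ^ i)

/-- `₁φ₁(a; b; q, z) = ∑_n (a;q)_n z^n / ((q;q)_n (b;q)_n) · (-1)^n q^{n(n-1)/2}`. -/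
def phi11 (a b q z : ℝ) : ℝ :=
  ∑' n : ℕ, qPoch a q n * z ^ n / (qPoch q q n * qPoch b q n) *
    ((-1) ^ n * q ^ (n * (n - 1) / 2))

/-! ### The algebra `A_q(SU(1,1))` -/

/-- The four generators `α, β, γ, δ`. -/
inductive Gen
  | a | b | c | d

/-- The defining relations. -/
inductive Rel (q : ℝ) : FreeAlgebra ℂ Gen → FreeAlgebra ℂ Gen → Prop
  | ab : Rel q (FreeAlgebra.ι ℂ Gen.a * FreeAlgebra.ι ℂ Gen.b)
      ((q : ℂ) • (FreeAlgebra.ι ℂ Gen.b * FreeAlgebra.ι ℂ Gen.a))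
  | ac : Rel q (FreeAlgebra.ι ℂ Gen.a * FreeAlgebra.ι ℂ Gen.c)
      ((q : ℂ) • (FreeAlgebra.ι ℂ Gen.c * FreeAlgebra.ι ℂ Gen.a))
  | bd : Rel q (FreeAlgebra.ι ℂ Gen.b * FreeAlgebra.ι ℂ Gen.d)
      ((q : ℂ) • (FreeAlgebra.ι ℂ Gen.d * FreeAlgebra.ι ℂ Gen.b))
  | cd : Rel q (FreeAlgebra.ι ℂ Gen.c * FreeAlgebra.ι ℂ Gen.d)
      ((q : ℂ) • (FreeAlgebra.ι ℂ Gen.d * FreeAlgebra.ι ℂ Gen.c))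
  | bc : Rel q (FreeAlgebra.ι ℂ Gen.b * FreeAlgebra.ι ℂ Gen.c)
      (FreeAlgebra.ι ℂ Gen.c * FreeAlgebra.ι ℂ Gen.b)
  | det : Rel q (FreeAlgebra.ι ℂ Gen.a * FreeAlgebra.ι ℂ Gen.d
      - (q : ℂ) • (FreeAlgebra.ι ℂ Gen.b * FreeAlgebra.ι ℂ Gen.c)) 1
  | det' : Rel q (FreeAlgebra.ι ℂ Gen.d * FreeAlgebra.ι ℂ Gen.a
      - (q : ℂ)⁻¹ • (FreeAlgebra.ι ℂ Gen.b * FreeAlgebra.ι ℂ Gen.c)) 1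

/-- The unital complex algebra `A_q(SL(2,ℂ))`, which is the algebra underlying the `*`-algebra
`A_q(SU(1,1))`, whose involution is given by `α* = δ`, `β* = qγ`, `γ* = q⁻¹β`, `δ* = α`. -/
abbrev Aq (q : ℝ) : Type := RingQuot (Rel q)

/-- The class of a generator in `A_q`. -/
def gen (q : ℝ) (g : Gen) : Aq q := RingQuot.mkAlgHom ℂ (Rel q) (FreeAlgebra.ι ℂ g)

/-- `α_{∞,t} = q^{1/2} α + q^{-1/2} t β`. -/
def alphaInf (q t : ℝ) : Aq q :=
  ((q ^ (1 / 2 : ℝ) : ℝ) : ℂ) • gen q Gen.a + ((q ^ (-1 / 2 : ℝ) * t : ℝ) : ℂ) • gen q Gen.b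

/-- `β_{∞,t} = q^{1/2} t α + q^{-1/2} β`. -/
def betaInf (q t : ℝ) : Aq q :=
  ((q ^ (1 / 2 : ℝ) * t : ℝ) : ℂ) • gen q Gen.a + ((q ^ (-1 / 2 : ℝ) : ℝ) : ℂ) • gen q Gen.b

/-- `γ_{∞,t} = q^{1/2} γ + q^{-1/2} t δ`. -/
def gammaInf (q t : ℝ) : Aq q :=
  ((q ^ (1 / 2 : ℝ) : ℝ) : ℂ) • gen q Gen.c + ((q ^ (-1 / 2 : ℝ) * t : ℝ) : ℂ) • gen q Gen.d

/-- `δ_{∞,t} = q^{1/2} t γ + q^{-1/2} δ`. -/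
def deltaInf (q t : ℝ) : Aq q :=
  ((q ^ (1 / 2 : ℝ) * t : ℝ) : ℂ) • gen q Gen.c + ((q ^ (-1 / 2 : ℝ) : ℝ) : ℂ) • gen q Gen.d

/-! ### The representation `π_λ` on finite linear combinations of the `e_k` -/

/-- The space `𝒟(ℤ)` of finite linear combinations of the basis vectors `e_k`, `k ∈ ℤ`. -/
abbrev DZ : Type := ℤ →₀ ℂ

/-- The action of the generators (recall `δ = α*` and `β = qγ*`):
`α e_k = √(1 + |λ|² q^{-2k}) e_{k+1}`, `γ e_k = λ q^{-k} e_k`,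
`δ e_k = √(1 + |λ|² q^{2-2k}) e_{k-1}`, `β e_k = q · conj(λ) q^{-k} e_k`. -/
def genAct (q : ℝ) (l : ℂ) : Gen → Module.End ℂ DZ
  | Gen.a => Finsupp.linearCombination ℂ fun k : ℤ =>
      Finsupp.single (k + 1) ((Real.sqrt (1 + ‖l‖ ^ 2 * q ^ (-2 * k)) : ℝ) : ℂ)
  | Gen.b => Finsupp.linearCombination ℂ fun k : ℤ =>
      Finsupp.single k ((q : ℂ) * ((starRingEnd ℂ) l * (q : ℂ) ^ (-k)))
  | Gen.c => Finsupp.linearCombination ℂ fun k : ℤ =>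
      Finsupp.single k (l * (q : ℂ) ^ (-k))
  | Gen.d => Finsupp.linearCombination ℂ fun k : ℤ =>
      Finsupp.single (k - 1) ((Real.sqrt (1 + ‖l‖ ^ 2 * q ^ (2 - 2 * k)) : ℝ) : ℂ)

theorem genAct_rel {q : ℝ} (hq : 0 < q) (l : ℂ) {x y : FreeAlgebra ℂ Gen} (h : Rel q x y) :
    FreeAlgebra.lift ℂ (genAct q l) x = FreeAlgebra.lift ℂ (genAct q l) y := by
  have hq' : (q : ℂ) ≠ 0 := by exact_mod_cast hq.ne'
  have hsq : ∀ k : ℤ, ((Real.sqrt (1 + ‖l‖ ^ 2 * q ^ k) : ℝ) : ℂ) *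
      ((Real.sqrt (1 + ‖l‖ ^ 2 * q ^ k) : ℝ) : ℂ) = 1 + l * (starRingEnd ℂ) l * (q : ℂ) ^ k := by
    intro k
    rw [← Complex.ofReal_mul, Real.mul_self_sqrt (by positivity), Complex.mul_conj,
      Complex.normSq_eq_norm_sq]
    push_cast
    ring
  have e1 : ∀ k : ℤ, 2 - 2 * (k + 1) = -2 * k := fun k => by ring
  have e2 : ∀ k : ℤ, -2 * (k - 1) = 2 - 2 * k := fun k => by ring
  have z1 : ∀ k : ℤ, (q : ℂ) ^ (-2 * k) = (q : ℂ) ^ (-k) * (q : ℂ) ^ (-k) := fun k => by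
    rw [← zpow_add₀ hq']; congr 1; ring
  have z2 : ∀ k : ℤ, (q : ℂ) ^ (2 - 2 * k) = (q : ℂ) ^ 2 * ((q : ℂ) ^ (-k) * (q : ℂ) ^ (-k)) :=
    fun k => by
      rw [← zpow_add₀ hq', ← zpow_natCast (q : ℂ) 2, ← zpow_add₀ hq']; congr 1; push_cast; ring
  have z3 : ∀ k : ℤ, (q : ℂ) * (q : ℂ) ^ (-(k + 1)) = (q : ℂ) ^ (-k) := fun k => by
    rw [← zpow_one_add₀ hq']; congr 1; ring
  have z4 : ∀ k : ℤ, (q : ℂ) ^ (-(k - 1)) = (q : ℂ) * (q : ℂ) ^ (-k) := fun k => by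
    rw [← zpow_one_add₀ hq']; congr 1; ring
  cases h <;> refine Finsupp.lhom_ext' fun k => LinearMap.ext_ring ?_ <;>
    simp only [map_mul, map_sub, map_smul, map_one, FreeAlgebra.lift_ι_apply,
      LinearMap.comp_apply, Finsupp.lsingle_apply, Module.End.mul_apply, LinearMap.sub_apply,
      LinearMap.smul_apply, Module.End.one_apply, genAct, Finsupp.linearCombination_single,
      one_smul, Finsupp.smul_single, smul_eq_mul, ← Finsupp.single_sub, add_sub_cancel_right,
      sub_add_cancel] <;> congr 1
  · linear_combination (-(Real.sqrt (1 + ‖l‖ ^ 2 * q ^ (-2 * k)) : ℂ) * (starRingEnd ℂ) l * q) * z3 k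
  · linear_combination (-(Real.sqrt (1 + ‖l‖ ^ 2 * q ^ (-2 * k)) : ℂ) * l) * z3 k
  · rw [z4]; ring
  · rw [z4]; ring
  · ring
  · rw [e2, hsq, z2]; ring
  · rw [e1, hsq, z1]; field_simp; ring

/-- The representation `π_λ` of `A_q(SU(1,1))` by linear operators on `𝒟(ℤ)`. -/
def rep {q : ℝ} (hq : 0 < q) (l : ℂ) : Aq q →ₐ[ℂ] Module.End ℂ DZ :=
  RingQuot.liftAlgHom ℂ ⟨FreeAlgebra.lift ℂ (genAct q l), fun _ _ h => genAct_rel hq l h⟩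

theorem rep_gen {q : ℝ} (hq : 0 < q) (l : ℂ) (g : Gen) :
    rep hq l (gen q g) = genAct q l g := by
  simp [rep, gen]

/-! ### Operators on `ℓ²(ℤ)` -/

/-- The Hilbert space `ℓ²(ℤ)`. -/
abbrev L2Z : Type := lp (fun _ : ℤ => ℂ) 2

/-- The standard orthonormal basis vector `e_k` of `ℓ²(ℤ)`. -/
def basisVec (k : ℤ) : L2Z := lp.single 2 k (1 : ℂ)

/-- The inclusion of `𝒟(ℤ)` in `ℓ²(ℤ)`. -/
def incl : DZ →ₗ[ℂ] L2Z := Finsupp.linearCombination ℂ basisVec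

/-- `𝒟(Q) = {∑ c_k e_k ∈ ℓ²(ℤ) | ∑ |c_k|² q^{-2k} < ∞}`. -/
def DQ (q : ℝ) : Submodule ℂ L2Z where
  carrier := {c | Summable fun k : ℤ => ‖c k‖ ^ 2 * q ^ (-2 * k)}
  zero_mem' := by
    simp
  add_mem' := by
    intro x y hx hy
    have hpos : ∀ k : ℤ, 0 ≤ q ^ (-2 * k) := fun k => Even.zpow_nonneg ⟨-k, by ring⟩ q
    refine Summable.of_nonneg_of_le (fun k => mul_nonneg (by positivity) (hpos k)) (fun k => ?_)
      ((hx.mul_left 2).add (hy.mul_left 2))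
    have h1 : ‖(x + y) k‖ ≤ ‖x k‖ + ‖y k‖ := norm_add_le _ _
    have h2 : ‖(x + y) k‖ ^ 2 ≤ 2 * ‖x k‖ ^ 2 + 2 * ‖y k‖ ^ 2 := by
      have := pow_le_pow_left₀ (norm_nonneg _) h1 2
      nlinarith [sq_nonneg (‖x k‖ - ‖y k‖)]
    nlinarith [mul_le_mul_of_nonneg_right h2 (hpos k)]
  smul_mem' := by
    intro a x hx
    have h := hx.mul_left (‖a‖ ^ 2)
    refine h.congr fun k => ?_
    have : (a • x) k = a * x k := rfl
    rw [this, norm_mul]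
    ring

/-- An operator `T` on `𝒟(ℤ)` acting by the same formula, `∑ c_k e_k ↦ ∑ c_k T e_k`, on those
elements `∑ c_k e_k` of `𝒟(Q)` for which the series on the right converges in `ℓ²(ℤ)`. -/
def extend (q : ℝ) (T : Module.End ℂ DZ) : L2Z →ₗ.[ℂ] L2Z where
  domain :=
    { carrier := {c | c ∈ DQ q ∧ Summable fun k : ℤ => c k • incl (T (Finsupp.single k 1))}
      zero_mem' := ⟨(DQ q).zero_mem, by
        simp⟩
      add_mem' := by
        intro x y hx hy
        refine ⟨(DQ q).add_mem hx.1 hy.1, (hx.2.add hy.2).congr fun k => ?_⟩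
        exact (add_smul _ _ _).symm
      smul_mem' := by
        intro a x hx
        refine ⟨(DQ q).smul_mem a hx.1, (hx.2.const_smul a).congr fun k => ?_⟩
        exact smul_smul _ _ _ }
  toFun :=
    { toFun := fun c => ∑' k : ℤ, (c : L2Z) k • incl (T (Finsupp.single k 1))
      map_add' := by
        intro x y
        rw [← x.2.2.tsum_add y.2.2]
        exact tsum_congr fun k => add_smul _ _ _
      map_smul' := by
        intro a x
        rw [RingHom.id_apply, ← x.2.2.tsum_const_smul a]
        exact tsum_congr fun k => (smul_smul a _ _).symm }

/-- The unbounded operator `π_{e^{iθ}}(a)` on `ℓ²(ℤ)`, for `a ∈ A_q(SU(1,1))`, extended from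
`𝒟(ℤ)` to (the part where the series converges of) `𝒟(Q)`. -/
def piOp {q : ℝ} (hq : 0 < q) (θ : ℝ) (a : Aq q) : L2Z →ₗ.[ℂ] L2Z :=
  extend q (rep hq (Complex.exp (Complex.I * θ)) a)

/-! ### The vectors `v^θ_p(t)` and `w^θ_p(t)` -/

/-- `V_k(x;t) = (-q^{2-2k};q²)_∞^{1/2} q^{k(k+1)/2} (-t)^{-k}
  ₁φ₁(-(xt)⁻¹; q² t⁻²; q², x q^{2k+2} t⁻¹)`. -/
def V (q : ℝ) (k : ℤ) (x t : ℝ) : ℝ :=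
  Real.sqrt (qPochInf (-q ^ (2 - 2 * k)) (q ^ 2)) * q ^ ((1 / 2 : ℝ) * k * (k + 1)) *
    (-t) ^ (-k) * phi11 (-(x * t)⁻¹) (q ^ 2 * t ^ (-2 : ℤ)) (q ^ 2) (x * q ^ (2 * k + 2) * t⁻¹)

/-- The coefficients `e^{ikθ} V_k(x;t)`, `k ∈ ℤ`. -/
def coeffs (q θ x t : ℝ) : ℤ → ℂ :=
  fun k => Complex.exp (Complex.I * k * θ) * (V q k x t : ℂ)

open Classical in
/-- The element `∑ c_k e_k` of `ℓ²(ℤ)`; it is set to `0` if `c` is not square summable. -/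
def ofCoeffs (c : ℤ → ℂ) : L2Z := if h : Memℓp c 2 then ⟨c, h⟩ else 0

/-- `v^θ_p(t) = ∑_k e^{ikθ} V_k(-q^{2p} t⁻¹; t) e_k`. -/
def v (q θ : ℝ) (p : ℤ) (t : ℝ) : L2Z := ofCoeffs (coeffs q θ (-q ^ (2 * p) * t⁻¹) t)

/-- `w^θ_p(t) = ∑_k e^{ikθ} V_k(q^{2p} t; t) e_k`. -/
def w (q θ : ℝ) (p : ℤ) (t : ℝ) : L2Z := ofCoeffs (coeffs q θ (q ^ (2 * p) * t) t)

/-- `x` lies in the domain of the partially defined operator `T`, and `T x = y`. -/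
def MapsVec (T : L2Z →ₗ.[ℂ] L2Z) (x y : L2Z) : Prop :=
  ∃ h : x ∈ T.domain, T ⟨x, h⟩ = y

end QSU11

end

/-!
Write `V_k(x; s) = A_k(s) S_k(x; s)`, where `S_k(x; s)` is the `₁φ₁`-factor. The operators
`π(α_{∞,t})` and `π(β_{∞,t})` are two-term shifts `e_k ↦ a_k e_{k+1} + b_k e_k`, while
`π(γ_{∞,t})` and `π(δ_{∞,t})` are two-term shifts `e_k ↦ a_k e_{k-1} + b_k e_k`. Comparing
coefficients of `e_k` and dividing by the amplitude, each action formula becomes a contiguous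
relation of `₁φ₁`.

For square summability, `A_{k+1}(s)² = (1 + q^{2k}) (q/s)² A_k(s)²`, so that `A_k(s)²` decays
like `(q/s)^{2k}` as `k → ∞` and faster than any exponential as `k → -∞`. It is therefore enough
that `S_k(x; s)` is `O((1 + q^{2k})^N)`. Write `q` for the base `q²` from here on. A contiguous
relation reduces this growth bound from the parameters `(a, b)` to `(aq, bq)`. For `v_p` the series
becomes `₁φ₁(1; b; z) = 1` after `p` such steps. For `w_p` the argument is an integral power of
`q`, and one shifts until `|a| < 1`; then the `q`-binomial theorem gives Heine's transformation,
which expands `₁φ₁(a; b; q^k)` in the values `₁φ₁(0; 0; q^{k+m})`, `m ≥ 0`. These are bounded in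
`k` and `m`, since `₁φ₁(0; 0; z) = (z; q)_∞` is bounded on `|z| ≤ 1` and vanishes at `z = q^{-j}`.
-/

noncomputable section

namespace QSU11

open Filter Topology Asymptotics

theorem summable_of_ratio_tendsto {R : Type*} [NormedRing R] [CompleteSpace R] {f g : ℕ → R}
    {l : R} (h : ∀ n, f (n + 1) = g n * f n) (hg : Tendsto g atTop (𝓝 l)) (hl : ‖l‖ < 1) :
    Summable f := by
  obtain ⟨r, hr, hr1⟩ := exists_between hl
  refine summable_of_ratio_norm_eventually_le hr1 ?_
  filter_upwards [hg.norm.eventually_le_const hr] with n hn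
  rw [h]
  exact (norm_mul_le _ _).trans (mul_le_mul_of_nonneg_right hn (norm_nonneg _))

theorem summable_int_of_ratio_tendsto {𝕜 : Type*} [NormedField 𝕜] [CompleteSpace 𝕜]
    {f g : ℤ → 𝕜} {l : 𝕜} (h : ∀ k, f (k + 1) = g k * f k)
    (hg : Tendsto (fun n : ℕ => g n) atTop (𝓝 l)) (hl : ‖l‖ < 1)
    (hg' : Tendsto (fun n : ℕ => ‖g (-n)‖) atTop atTop) : Summable f := by
  refine .of_nat_of_neg
    (summable_of_ratio_tendsto (g := fun n : ℕ => g n) (fun n => by exact_mod_cast h n) hg hl) ?_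
  refine summable_of_ratio_norm_eventually_le (r := 1 / 2) (by norm_num) ?_
  filter_upwards [(tendsto_add_atTop_iff_nat 1).2 hg' |>.eventually_ge_atTop 2] with n hn
  have hstep : ‖f (-n)‖ = ‖g (-(n + 1 : ℕ))‖ * ‖f (-(n + 1 : ℕ))‖ := by
    rw [← norm_mul, ← h]
    congr 2
    push_cast
    ring
  have := mul_le_mul_of_nonneg_right hn (norm_nonneg (f (-(n + 1 : ℕ))))
  rw [hstep]
  linarith

theorem hasSum_of_hasSum_succ {G : Type*} [AddCommGroup G] [TopologicalSpace G]
    [IsTopologicalAddGroup G] {f g : ℕ → G} {s : G} (h0 : f 0 = 0) (h : ∀ n, f (n + 1) = g n)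
    (hg : HasSum g s) : HasSum f s := by
  refine (hasSum_nat_add_iff' 1).1 ?_
  simpa [h0, h] using hg

section QPochhammer

variable {a b q : ℝ}

theorem qPoch_succ (a q : ℝ) (n : ℕ) : qPoch a q (n + 1) = qPoch a q n * (1 - a * q ^ n) :=
  Finset.prod_range_succ _ _

theorem qPoch_succ' (a q : ℝ) (n : ℕ) : qPoch a q (n + 1) = (1 - a) * qPoch (a * q) q n := by
  simp only [qPoch, Finset.prod_range_succ', pow_zero, mul_one, pow_succ', mul_assoc]
  exact mul_comm _ _

theorem qPoch_ne_zero (hb : ∀ n : ℕ, b * q ^ n ≠ 1) (n : ℕ) : qPoch b q n ≠ 0 :=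
  Finset.prod_ne_zero_iff.2 fun i _ => sub_ne_zero.2 (hb i).symm

theorem mul_mul_pow_ne_one (hb : ∀ n : ℕ, b * q ^ n ≠ 1) (n : ℕ) : b * q * q ^ n ≠ 1 := by
  rw [mul_assoc, ← pow_succ']
  exact hb (n + 1)

theorem abs_mul_pow_lt_one (hq : |q| < 1) (hb : |b| < 1) (n : ℕ) : |b * q ^ n| < 1 := by
  rw [abs_mul, abs_pow]
  exact mul_lt_one_of_nonneg_of_lt_one_left (abs_nonneg _) hb (pow_le_one₀ (abs_nonneg _) hq.le)

theorem mul_pow_ne_one (hq : |q| < 1) (hb : |b| < 1) (n : ℕ) : b * q ^ n ≠ 1 :=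
  ne_of_apply_ne abs (by simpa using (abs_mul_pow_lt_one hq hb n).ne)

theorem tendsto_one_sub_mul_pow (hq : |q| < 1) (c : ℝ) :
    Tendsto (fun n : ℕ => 1 - c * q ^ n) atTop (𝓝 1) := by
  simpa using ((tendsto_pow_atTop_nhds_zero_of_abs_lt_one hq).const_mul c).const_sub 1

theorem qPochInf_eq_mul (hq : |q| < 1) (a : ℝ) :
    qPochInf a q = (1 - a) * qPochInf (a * q) q := by
  have hm : Multipliable fun i : ℕ => 1 - a * q ^ (i + 1) := by
    refine (Real.multipliable_one_add_of_summable
      ((summable_geometric_of_abs_lt_one hq).mul_left (-(a * q)))).congr fun i => ?_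
    ring
  rw [qPochInf, tprod_eq_zero_mul' (f := fun i : ℕ => 1 - a * q ^ i) hm]
  simp only [pow_zero, mul_one, pow_succ', mul_assoc, qPochInf]

end QPochhammer

section PhiSeries

variable {a b q z : ℝ}

/-- The `n`-th term of the series defining `phi11 a b q z`. -/
def phiTerm (a b q z : ℝ) (n : ℕ) : ℝ :=
  qPoch a q n * z ^ n / (qPoch q q n * qPoch b q n) * ((-1) ^ n * q ^ (n * (n - 1) / 2))

theorem phiTerm_zero (a b q z : ℝ) : phiTerm a b q z 0 = 1 := by simp [phiTerm, qPoch]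

theorem phiTerm_arg_mul (a b q y z : ℝ) (n : ℕ) :
    phiTerm a b q (y * z) n = y ^ n * phiTerm a b q z n := by
  simp only [phiTerm, mul_pow]; ring

theorem phiTerm_succ (a b q z : ℝ) (n : ℕ) :
    phiTerm a b q z (n + 1) =
      -((1 - a * q ^ n) * z * q ^ n) / ((1 - q * q ^ n) * (1 - b * q ^ n)) * phiTerm a b q z n := by
  simp only [phiTerm, Nat.triangle_succ, qPoch_succ, pow_succ z, pow_succ (-1 : ℝ), pow_add q,
    div_eq_mul_inv, mul_inv]
  ring

theorem hasSum_phi11 (hq : |q| < 1) (a b z : ℝ) : HasSum (phiTerm a b q z) (phi11 a b q z) := by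
  refine (summable_of_ratio_tendsto (phiTerm_succ a b q z) (l := 0) ?_ (by simp)).hasSum
  have h := (((tendsto_one_sub_mul_pow hq a).mul_const z).mul
    (tendsto_pow_atTop_nhds_zero_of_abs_lt_one hq)).neg.div
    ((tendsto_one_sub_mul_pow hq q).mul (tendsto_one_sub_mul_pow hq b)) (by simp)
  simpa only [mul_zero, neg_zero, zero_div, Pi.div_def] using h

theorem phi11_one (b q z : ℝ) : phi11 1 b q z = 1 := by
  refine (tsum_eq_single 0 fun n hn => ?_).trans (phiTerm_zero 1 b q z)
  obtain ⟨m, rfl⟩ := Nat.exists_eq_succ_of_ne_zero hn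
  simp [qPoch_succ']

theorem phiTerm_succ_sub_arg_mul (hq : |q| < 1) (hb : b ≠ 1) (a z : ℝ) (n : ℕ) :
    (1 - b) * (phiTerm a b q z (n + 1) - phiTerm a b q (q * z) (n + 1)) =
      -z * (1 - a) * phiTerm (a * q) (b * q) q (q * z) n := by
  have hb0 : 1 - b ≠ 0 := sub_ne_zero.2 hb.symm
  have hqn : 1 - q * q ^ n ≠ 0 := sub_ne_zero.2 (mul_pow_ne_one hq hq n).symm
  simp only [phiTerm, Nat.triangle_succ, qPoch_succ' a, qPoch_succ' b, qPoch_succ q, mul_pow,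
    pow_succ z, pow_succ (-1 : ℝ), pow_add q, pow_succ' q]
  field_simp
  ring

theorem phiTerm_succ_sub_top_mul (hq : |q| < 1) (hb : b ≠ 1) (a z : ℝ) (n : ℕ) :
    (1 - b) * (phiTerm a b q z (n + 1) - phiTerm (a * q) b q z (n + 1)) =
      z * a * phiTerm (a * q) (b * q) q (q * z) n := by
  have hb0 : 1 - b ≠ 0 := sub_ne_zero.2 hb.symm
  have hqn : 1 - q * q ^ n ≠ 0 := sub_ne_zero.2 (mul_pow_ne_one hq hq n).symm
  simp only [phiTerm, Nat.triangle_succ, qPoch_succ' a, qPoch_succ (a * q), qPoch_succ' b,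
    qPoch_succ q, mul_pow, pow_succ z, pow_succ (-1 : ℝ), pow_add q]
  field_simp
  ring

theorem phiTerm_top_mul (a b q z : ℝ) (n : ℕ) :
    (1 - a) * phiTerm (a * q) b q z n = (1 - a * q ^ n) * phiTerm a b q z n := by
  have h : (1 - a) * qPoch (a * q) q n = qPoch a q n * (1 - a * q ^ n) := by
    rw [← qPoch_succ', qPoch_succ]
  simp only [phiTerm]
  linear_combination (z ^ n / (qPoch q q n * qPoch b q n) * ((-1) ^ n * q ^ (n * (n - 1) / 2))) * h

theorem phiTerm_bottom_mul (hb : ∀ n : ℕ, b * q ^ n ≠ 1) (a z : ℝ) (n : ℕ) :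
    (1 - b * q ^ n) * phiTerm a (b * q) q z n = (1 - b) * phiTerm a b q z n := by
  have h : qPoch b q n * (1 - b * q ^ n) = (1 - b) * qPoch (b * q) q n := by
    rw [← qPoch_succ', qPoch_succ]
  have h1 := qPoch_ne_zero (mul_mul_pow_ne_one hb) n
  have h2 := qPoch_ne_zero hb n
  simp only [phiTerm]
  field_simp
  linear_combination (qPoch a q n * z ^ n * (qPoch q q n)⁻¹ * q ^ (n * (n - 1) / 2)) * h

theorem phi11_sub_arg_mul (hq : |q| < 1) (hb : b ≠ 1) (a z : ℝ) :
    (1 - b) * (phi11 a b q z - phi11 a b q (q * z)) =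
      -z * (1 - a) * phi11 (a * q) (b * q) q (q * z) := by
  refine (((hasSum_phi11 hq a b z).sub (hasSum_phi11 hq a b (q * z))).mul_left (1 - b)).unique ?_
  refine hasSum_of_hasSum_succ ?_ (phiTerm_succ_sub_arg_mul hq hb a z)
    ((hasSum_phi11 hq _ _ _).mul_left _)
  simp [phiTerm_zero]

theorem phi11_sub_top_mul (hq : |q| < 1) (hb : b ≠ 1) (a z : ℝ) :
    (1 - b) * (phi11 a b q z - phi11 (a * q) b q z) =
      z * a * phi11 (a * q) (b * q) q (q * z) := by
  refine (((hasSum_phi11 hq a b z).sub (hasSum_phi11 hq (a * q) b z)).mul_left (1 - b)).unique ?_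
  refine hasSum_of_hasSum_succ ?_ (phiTerm_succ_sub_top_mul hq hb a z)
    ((hasSum_phi11 hq _ _ _).mul_left _)
  simp [phiTerm_zero]

theorem phi11_of_bottom_mul (hq : |q| < 1) (hb : ∀ n : ℕ, b * q ^ n ≠ 1) (a z : ℝ) :
    phi11 a (b * q) q z - b * phi11 a (b * q) q (q * z) = (1 - b) * phi11 a b q z := by
  refine ((hasSum_phi11 hq a (b * q) z).sub
    ((hasSum_phi11 hq a (b * q) (q * z)).mul_left b)).unique
    (((hasSum_phi11 hq a b z).mul_left (1 - b)).congr_fun fun n => ?_)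
  rw [phiTerm_arg_mul]
  linear_combination phiTerm_bottom_mul hb a z n

theorem phi11_add_bottom_mul (hq : |q| < 1) (hb : ∀ n : ℕ, b * q ^ n ≠ 1) (a z : ℝ) :
    a * (1 - b) * phi11 a b q z + (b - a) * phi11 a (b * q) q z =
      b * (1 - a) * phi11 (a * q) (b * q) q z := by
  refine (((hasSum_phi11 hq a b z).mul_left (a * (1 - b))).add
    ((hasSum_phi11 hq a (b * q) z).mul_left (b - a))).unique
    (((hasSum_phi11 hq (a * q) (b * q) z).mul_left (b * (1 - a))).congr_fun fun n => ?_)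
  linear_combination -b * phiTerm_top_mul a (b * q) q z n - a * phiTerm_bottom_mul hb a z n

theorem phi11_of_top_bottom_mul (hq : |q| < 1) (hb : ∀ n : ℕ, b * q ^ n ≠ 1) (a z : ℝ) :
    phi11 (a * q) (b * q) q z - (b - z * a) * phi11 (a * q) (b * q) q (q * z) =
      (1 - b) * phi11 a b q z := by
  have hb1 : b ≠ 1 := by simpa using hb 0
  linear_combination phi11_of_bottom_mul hq hb (a * q) z - phi11_sub_top_mul hq hb1 a z

theorem phi11_bottom_mul_arg_mul (hq : |q| < 1) (hb : ∀ n : ℕ, b * q ^ n ≠ 1) (a z : ℝ) :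
    (1 - b) * ((b - z * a) * phi11 a b q (q * z) - b * phi11 a b q z) =
      z * (b - a) * phi11 a (b * q) q (q * z) := by
  have hb1 : b ≠ 1 := by simpa using hb 0
  linear_combination -b * phi11_sub_arg_mul hq hb1 a z - z * phi11_add_bottom_mul hq hb a (q * z)

theorem phi11_zero_zero (hq : |q| < 1) (z : ℝ) :
    phi11 0 0 q z = (1 - z) * phi11 0 0 q (q * z) := by
  have h := phi11_sub_arg_mul hq zero_ne_one 0 z
  simp only [sub_zero, zero_mul] at h
  linear_combination h

end PhiSeries

section Heine

variable {a b c q x z : ℝ}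

theorem abs_phi11_le (hq : |q| < 1) (a b : ℝ) (hz : |z| ≤ 1) :
    |phi11 a b q z| ≤ ∑' n, |phiTerm a b q 1 n| := by
  rw [← Real.norm_eq_abs, ← (hasSum_phi11 hq a b z).tsum_eq]
  refine tsum_of_norm_bounded (hasSum_phi11 hq a b 1).summable.abs.hasSum fun n => ?_
  rw [← mul_one z, phiTerm_arg_mul, norm_mul, norm_pow, Real.norm_eq_abs, Real.norm_eq_abs]
  exact mul_le_of_le_one_left (abs_nonneg _) (pow_le_one₀ (abs_nonneg _) hz)

theorem phi11_zero_zero_inv_pow (hq0 : q ≠ 0) (hq : |q| < 1) (j : ℕ) :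
    phi11 0 0 q (q ^ j)⁻¹ = 0 := by
  induction j with
  | zero => rw [phi11_zero_zero hq, pow_zero, inv_one, sub_self, zero_mul]
  | succ j ih =>
    rw [phi11_zero_zero hq, pow_succ', mul_inv, mul_inv_cancel_left₀ hq0, ih, mul_zero]

theorem abs_phi11_zero_zero_zpow_le (hq0 : q ≠ 0) (hq : |q| < 1) (j : ℤ) :
    |phi11 0 0 q (q ^ j)| ≤ ∑' n, |phiTerm 0 0 q 1 n| := by
  obtain ⟨n, rfl | rfl⟩ := Int.eq_nat_or_neg j
  · refine abs_phi11_le hq 0 0 ?_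
    rw [zpow_natCast, abs_pow]
    exact pow_le_one₀ (abs_nonneg _) hq.le
  · rw [zpow_neg, zpow_natCast, phi11_zero_zero_inv_pow hq0 hq, abs_zero]
    exact tsum_nonneg fun n => abs_nonneg _

/-- The `n`-th term `(c; q)_n x^n / (q; q)_n` of the `q`-binomial series. -/
def binTerm (c q x : ℝ) (n : ℕ) : ℝ := qPoch c q n * x ^ n / qPoch q q n

/-- The `q`-binomial series `₁φ₀(c; -; q, x) = ∑_n (c; q)_n x^n / (q; q)_n`. -/
def qBin (c q x : ℝ) : ℝ := ∑' n, binTerm c q x n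

theorem binTerm_zero (c q x : ℝ) : binTerm c q x 0 = 1 := by simp [binTerm, qPoch]

theorem binTerm_mul (c q x y : ℝ) (n : ℕ) : binTerm c q (x * y) n = y ^ n * binTerm c q x n := by
  simp only [binTerm, mul_pow]; ring

theorem binTerm_succ (c q x : ℝ) (n : ℕ) :
    binTerm c q x (n + 1) = (1 - c * q ^ n) * x / (1 - q * q ^ n) * binTerm c q x n := by
  simp only [binTerm, qPoch_succ, pow_succ x, div_eq_mul_inv, mul_inv]
  ring

theorem hasSum_qBin (hq : |q| < 1) (hx : |x| < 1) (c : ℝ) :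
    HasSum (binTerm c q x) (qBin c q x) := by
  refine (summable_of_ratio_tendsto (binTerm_succ c q x) (l := x) ?_ hx).hasSum
  simpa only [one_mul, div_one, Pi.div_def] using
    ((tendsto_one_sub_mul_pow hq c).mul_const x).div (tendsto_one_sub_mul_pow hq q) one_ne_zero

theorem qBin_functional_equation (hq : |q| < 1) (hx : |x| < 1) (c : ℝ) :
    (1 - x) * qBin c q x = (1 - c * x) * qBin c q (x * q) := by
  have hB := hasSum_qBin hq hx c
  have hB' := hasSum_qBin hq (x := x * q) (by simpa using abs_mul_pow_lt_one hq hx 1) c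
  have hsucc (n : ℕ) : binTerm c q x (n + 1) - binTerm c q (x * q) (n + 1) =
      x * binTerm c q x n - c * x * binTerm c q (x * q) n := by
    have hqn : 1 - q * q ^ n ≠ 0 := sub_ne_zero.2 (mul_pow_ne_one hq hq n).symm
    have h : (1 - q * q ^ n) * binTerm c q x (n + 1) = (1 - c * q ^ n) * x * binTerm c q x n := by
      rw [binTerm_succ, ← mul_assoc, mul_div_cancel₀ _ hqn]
    rw [binTerm_mul, binTerm_mul]
    linear_combination h
  have h := (hB.sub hB').unique (hasSum_of_hasSum_succ (by simp [binTerm_zero]) hsucc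
    ((hB.mul_left x).sub (hB'.mul_left (c * x))))
  linear_combination h

theorem qBin_mul_pow (hq : |q| < 1) (hx : |x| < 1) (hcx : ∀ n : ℕ, c * x * q ^ n ≠ 1) (n : ℕ) :
    qBin c q (x * q ^ n) = qBin c q x * qPoch x q n / qPoch (c * x) q n := by
  induction n with
  | zero => simp [qPoch]
  | succ n ih =>
    have hn : 1 - c * x * q ^ n ≠ 0 := sub_ne_zero.2 (hcx n).symm
    have h := qBin_functional_equation hq (abs_mul_pow_lt_one hq hx n) c
    rw [ih, mul_assoc x, ← pow_succ, ← mul_assoc c] at h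
    rw [qPoch_succ, qPoch_succ, ← mul_assoc, ← div_div, eq_div_iff hn]
    linear_combination -h

theorem tendsto_qBin_mul_pow (hq : |q| < 1) (hx : |x| < 1) (c : ℝ) :
    Tendsto (fun n : ℕ => qBin c q (x * q ^ n)) atTop (𝓝 1) := by
  have h : Tendsto (fun n : ℕ => ∑' m, binTerm c q (x * q ^ n) m) atTop
      (𝓝 (∑' m, if m = 0 then 1 else 0)) := by
    refine tendsto_tsum_of_dominated_convergence (hasSum_qBin hq hx c).summable.abs
      (fun m => ?_) (Eventually.of_forall fun n m => ?_)
    · rcases eq_or_ne m 0 with rfl | hm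
      · simp [binTerm_zero]
      · simp only [binTerm_mul, if_neg hm]
        simpa [zero_pow hm] using
          ((tendsto_pow_atTop_nhds_zero_of_abs_lt_one hq).pow m).mul_const (binTerm c q x m)
    · rw [binTerm_mul, norm_mul, norm_pow, norm_pow, Real.norm_eq_abs, Real.norm_eq_abs]
      exact mul_le_of_le_one_left (abs_nonneg _)
        (pow_le_one₀ (by positivity) (pow_le_one₀ (abs_nonneg _) hq.le))
  simpa [qBin] using h

theorem qBin_ne_zero (hq : |q| < 1) (hx : |x| < 1) (hcx : ∀ n : ℕ, c * x * q ^ n ≠ 1) :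
    qBin c q x ≠ 0 := by
  intro h0
  have h := tendsto_qBin_mul_pow hq hx c
  simp only [qBin_mul_pow hq hx hcx, h0, zero_mul, zero_div] at h
  exact zero_ne_one (tendsto_nhds_unique tendsto_const_nhds h)

theorem qBin_mul_phi11 (hq : |q| < 1) (hx : |x| < 1) (hcx : ∀ n : ℕ, c * x * q ^ n ≠ 1) (z : ℝ) :
    qBin c q x * phi11 x (c * x) q z =
      ∑' m : ℕ, binTerm c q x m * phi11 0 0 q (q ^ m * z) := by
  have hphi := (hasSum_phi11 hq 0 0 z).summable
  have hbin := (hasSum_qBin hq hx c).summable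
  have hsum : Summable (Function.uncurry fun n m : ℕ =>
      phiTerm 0 0 q z n * (binTerm c q x m * (q ^ n) ^ m)) := by
    refine .of_norm_bounded (summable_mul_of_summable_norm hphi.norm hbin.norm).norm ?_
    rintro ⟨n, m⟩
    simp only [Function.uncurry, ← mul_assoc, norm_mul _ ((q ^ n) ^ m), norm_pow]
    exact mul_le_of_le_one_right (norm_nonneg _)
      (pow_le_one₀ (by positivity) (pow_le_one₀ (norm_nonneg _) hq.le))
  have hterm (n : ℕ) : qBin c q x * phiTerm x (c * x) q z n =
      ∑' m, phiTerm 0 0 q z n * (binTerm c q x m * (q ^ n) ^ m) := by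
    have hbin_n : ∑' m, binTerm c q x m * (q ^ n) ^ m =
        qBin c q x * qPoch x q n / qPoch (c * x) q n := by
      rw [← qBin_mul_pow hq hx hcx]
      exact tsum_congr fun m => by rw [binTerm_mul, mul_comm]
    have h0 : qPoch 0 q n = 1 := by simp [qPoch]
    rw [tsum_mul_left, hbin_n]
    simp only [phiTerm, h0, div_eq_mul_inv, mul_inv]
    ring
  calc qBin c q x * phi11 x (c * x) q z
      = ∑' (n) (m), phiTerm 0 0 q z n * (binTerm c q x m * (q ^ n) ^ m) := by
        rw [← tsum_congr hterm, tsum_mul_left]; rfl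
    _ = ∑' (m) (n), phiTerm 0 0 q z n * (binTerm c q x m * (q ^ n) ^ m) := hsum.tsum_comm.symm
    _ = _ := by
        refine tsum_congr fun m => ?_
        rw [phi11, ← tsum_mul_left]
        refine tsum_congr fun n => ?_
        change _ = _ * phiTerm 0 0 q (q ^ m * z) n
        rw [phiTerm_arg_mul, ← pow_mul, ← pow_mul, mul_comm m n]
        ring

theorem exists_abs_phi11_zpow_le (hq0 : q ≠ 0) (hq : |q| < 1) (hb : ∀ n : ℕ, b * q ^ n ≠ 1)
    (ha0 : a ≠ 0) (ha : |a| < 1) : ∃ C, ∀ k : ℤ, |phi11 a b q (q ^ k)| ≤ C := by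
  obtain ⟨c, rfl⟩ : ∃ c, b = c * a := ⟨b / a, (div_mul_cancel₀ b ha0).symm⟩
  have hpos := abs_pos.2 (qBin_ne_zero hq ha hb)
  refine ⟨(∑' m, |binTerm c q a m| * ∑' n, |phiTerm 0 0 q 1 n|) / |qBin c q a|, fun k => ?_⟩
  rw [le_div_iff₀ hpos, mul_comm, ← abs_mul, qBin_mul_phi11 hq ha hb, ← Real.norm_eq_abs]
  refine tsum_of_norm_bounded ((hasSum_qBin hq ha c).summable.abs.mul_right _).hasSum fun m => ?_
  rw [norm_mul, Real.norm_eq_abs, Real.norm_eq_abs, ← zpow_natCast q m, ← zpow_add₀ hq0]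
  exact mul_le_mul_of_nonneg_left (abs_phi11_zero_zero_zpow_le hq0 hq _) (abs_nonneg _)

end Heine

/-- Polynomial growth of `f : ℤ → ℝ` in the geometric progression `q ^ k`: for `0 < q < 1` the
function is bounded as `k → ∞` and at most of the order of a power of `q ^ k` as `k → -∞`. -/
def PolyGrowth (q : ℝ) (f : ℤ → ℝ) : Prop := ∃ N : ℕ, f =O[⊤] fun k => (1 + q ^ k) ^ N

namespace PolyGrowth

variable {q : ℝ} {f g : ℤ → ℝ}

theorem of_bounded {C : ℝ} (h : ∀ k, |f k| ≤ C) : PolyGrowth q f :=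
  ⟨0, by simpa only [pow_zero] using .of_bound C (Eventually.of_forall fun k => by simpa using h k)⟩

theorem zpow (hq : 0 < q) : PolyGrowth q fun k => q ^ k := by
  refine ⟨1, isBigO_of_le _ fun k => ?_⟩
  have := zpow_pos hq k
  rw [pow_one, Real.norm_of_nonneg this.le, Real.norm_of_nonneg (by positivity)]
  linarith

theorem isBigO_one_add_zpow_pow (hq : 0 < q) {M N : ℕ} (h : M ≤ N) :
    (fun k : ℤ => (1 + q ^ k) ^ M) =O[⊤] fun k => (1 + q ^ k) ^ N := by
  refine isBigO_of_le _ fun k => ?_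
  have := zpow_pos hq k
  rw [Real.norm_of_nonneg (by positivity), Real.norm_of_nonneg (by positivity)]
  exact pow_le_pow_right₀ (by linarith) h

theorem sub (hq : 0 < q) (hf : PolyGrowth q f) (hg : PolyGrowth q g) :
    PolyGrowth q fun k => f k - g k := by
  obtain ⟨M, hf⟩ := hf
  obtain ⟨N, hg⟩ := hg
  exact ⟨max M N, (hf.trans (isBigO_one_add_zpow_pow hq (le_max_left M N))).sub
    (hg.trans (isBigO_one_add_zpow_pow hq (le_max_right M N)))⟩

theorem mul (hf : PolyGrowth q f) (hg : PolyGrowth q g) : PolyGrowth q fun k => f k * g k := by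
  obtain ⟨M, hf⟩ := hf
  obtain ⟨N, hg⟩ := hg
  exact ⟨M + N, by simpa only [pow_add] using hf.mul hg⟩

theorem const (q c : ℝ) : PolyGrowth q fun _ => c := of_bounded fun _ => le_rfl

theorem comp_add (hq : 0 < q) (hf : PolyGrowth q f) (j : ℤ) : PolyGrowth q fun k => f (k + j) := by
  obtain ⟨N, hf⟩ := hf
  refine ⟨N, (hf.comp_tendsto (tendsto_top (f := fun k : ℤ => k + j))).trans
    (.pow (.of_bound (1 + q ^ j) (Eventually.of_forall fun k => ?_)) N)⟩
  have := zpow_pos hq k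
  have := zpow_pos hq j
  rw [Real.norm_of_nonneg (by positivity), Real.norm_of_nonneg (by positivity), zpow_add₀ hq.ne']
  nlinarith

end PolyGrowth

section Phi11Growth

variable {a b q z : ℝ}

theorem polyGrowth_phi11_of_mul (hq0 : 0 < q) (hq1 : q < 1) (hb : ∀ n : ℕ, b * q ^ n ≠ 1)
    (h : PolyGrowth q fun k => phi11 (a * q) (b * q) q (z * q ^ k)) :
    PolyGrowth q fun k => phi11 a b q (z * q ^ k) := by
  have hq : |q| < 1 := by rwa [abs_of_pos hq0]
  have hb1 : 1 - b ≠ 0 := sub_ne_zero.2 fun h => hb 0 (by simp [← h])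
  have hrec (k : ℤ) : phi11 a b q (z * q ^ k) = (1 - b)⁻¹ *
      (phi11 (a * q) (b * q) q (z * q ^ k) -
        (b - z * a * q ^ k) * phi11 (a * q) (b * q) q (z * q ^ (k + 1))) := by
    have := phi11_of_top_bottom_mul hq hb a (z * q ^ k)
    rw [eq_inv_mul_iff_mul_eq₀ hb1, ← this, zpow_add_one₀ hq0.ne']
    ring_nf
  simp only [hrec]
  have hcoeff : PolyGrowth q fun k => b - z * a * q ^ k :=
    .sub hq0 (.const q b) (.mul (.const q (z * a)) (.zpow hq0))
  exact .mul (.const q _) (h.sub hq0 (hcoeff.mul (h.comp_add hq0 1)))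

theorem polyGrowth_phi11_of_mul_pow (hq0 : 0 < q) (hq1 : q < 1) (j : ℕ) :
    ∀ {a b : ℝ}, (∀ n : ℕ, b * q ^ n ≠ 1) →
      (PolyGrowth q fun k => phi11 (a * q ^ j) (b * q ^ j) q (z * q ^ k)) →
      PolyGrowth q fun k => phi11 a b q (z * q ^ k) := by
  induction j with
  | zero => simp
  | succ j ih =>
    intro a b hb h
    simp only [pow_succ', ← mul_assoc] at h
    exact polyGrowth_phi11_of_mul hq0 hq1 hb (ih (mul_mul_pow_ne_one hb) h)

theorem polyGrowth_phi11_zpow (hq0 : 0 < q) (hq1 : q < 1) (hb : ∀ n : ℕ, b * q ^ n ≠ 1)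
    (ha : a ≠ 0) : PolyGrowth q fun k => phi11 a b q (q ^ k) := by
  have hq : |q| < 1 := by rwa [abs_of_pos hq0]
  have hlim := ((tendsto_pow_atTop_nhds_zero_of_abs_lt_one hq).const_mul a).abs
  rw [mul_zero, abs_zero] at hlim
  obtain ⟨j, hj⟩ := (hlim.eventually_lt_const one_pos).exists
  have hbj (n : ℕ) : b * q ^ j * q ^ n ≠ 1 := by
    rw [mul_assoc, ← pow_add]
    exact hb (j + n)
  obtain ⟨C, hC⟩ := exists_abs_phi11_zpow_le hq0.ne' hq hbj
    (mul_ne_zero ha (pow_ne_zero j hq0.ne')) hj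
  simpa using polyGrowth_phi11_of_mul_pow (z := 1) hq0 hq1 j hb
    (.of_bounded fun k => by simpa using hC k)

theorem polyGrowth_phi11_inv_pow (hq0 : 0 < q) (hq1 : q < 1) (hb : ∀ n : ℕ, b * q ^ n ≠ 1)
    (p : ℕ) (z : ℝ) : PolyGrowth q fun k => phi11 (q ^ p)⁻¹ b q (z * q ^ k) := by
  refine polyGrowth_phi11_of_mul_pow hq0 hq1 p hb ?_
  simp only [inv_mul_cancel₀ (pow_ne_zero p hq0.ne'), phi11_one]
  exact .const q 1

end Phi11Growth

section Vfunction

variable {q s t x : ℝ}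

/-- The factor `(-q^{2-2k}; q²)_∞^{1/2} q^{k(k+1)/2} (-s)^{-k}` of `V_k(x; s)`. -/
def amplitude (q : ℝ) (k : ℤ) (s : ℝ) : ℝ :=
  √(qPochInf (-q ^ (2 - 2 * k)) (q ^ 2)) * q ^ ((1 / 2 : ℝ) * k * (k + 1)) * (-s) ^ (-k)

/-- The factor `₁φ₁(-(xs)⁻¹; q² s⁻²; q², x q^{2k+2} s⁻¹)` of `V_k(x; s)`. -/
def series (q : ℝ) (k : ℤ) (x s : ℝ) : ℝ :=
  phi11 (-(x * s)⁻¹) (q ^ 2 * s ^ (-2 : ℤ)) (q ^ 2) (x * q ^ (2 * k + 2) * s⁻¹)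

theorem V_eq_amplitude_mul_series (q : ℝ) (k : ℤ) (x s : ℝ) :
    V q k x s = amplitude q k s * series q k x s := rfl

theorem abs_sq_lt_one (hq0 : 0 < q) (hq1 : q < 1) : |q ^ 2| < 1 := by
  rw [abs_of_pos (by positivity)]
  exact pow_lt_one₀ hq0.le hq1 two_ne_zero

theorem amplitude_add_one (hq0 : 0 < q) (hq1 : q < 1) (hs : s ≠ 0) (k : ℤ) :
    amplitude q (k + 1) s = -(√(1 + q ^ (-2 * k)) * q ^ (k + 1) * s⁻¹) * amplitude q k s := by
  have hpoch : qPochInf (-q ^ (2 - 2 * (k + 1))) (q ^ 2) =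
      (1 + q ^ (-2 * k)) * qPochInf (-q ^ (2 - 2 * k)) (q ^ 2) := by
    have e : q ^ (2 - 2 * k) = q ^ (-2 * k) * q ^ 2 := by
      rw [← zpow_natCast, ← zpow_add₀ hq0.ne']
      congr 1
      push_cast
      ring
    rw [qPochInf_eq_mul (abs_sq_lt_one hq0 hq1), show 2 - 2 * (k + 1) = -2 * k by ring, e,
      sub_neg_eq_add, neg_mul (q ^ (-2 * k))]
  have hgauss : q ^ ((1 / 2 : ℝ) * (k + 1 : ℤ) * ((k + 1 : ℤ) + 1)) =
      q ^ ((1 / 2 : ℝ) * k * (k + 1)) * q ^ (k + 1) := by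
    rw [← Real.rpow_intCast, ← Real.rpow_add hq0]
    congr 1
    push_cast
    ring
  have hpow : (-s) ^ (-(k + 1)) = -(s⁻¹ * (-s) ^ (-k)) := by
    rw [neg_add, zpow_add₀ (neg_ne_zero.2 hs), zpow_neg_one, inv_neg]
    ring
  rw [amplitude, amplitude, hpoch, hgauss, hpow, Real.sqrt_mul (by positivity)]
  ring

theorem amplitude_mul (q : ℝ) (k : ℤ) (s r : ℝ) :
    amplitude q k (s * r) = r ^ (-k) * amplitude q k s := by
  rw [amplitude, amplitude, ← neg_mul, mul_zpow]
  ring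

theorem abs_sq_mul_zpow_neg_two_lt_one (hq0 : 0 < q) (hs : q < |s|) :
    |q ^ 2 * s ^ (-2 : ℤ)| < 1 := by
  have e : q ^ 2 * s ^ (-2 : ℤ) = (q / |s|) ^ 2 := by
    rw [div_pow, sq_abs, zpow_neg, div_eq_mul_inv]
    norm_cast
  rw [e, abs_of_nonneg (by positivity)]
  exact pow_lt_one₀ (by positivity) ((div_lt_one (hq0.trans hs)).2 hs) two_ne_zero

theorem ne_of_abs_lt_one {b : ℝ} (hb : |b| < 1) : b ≠ 1 := by
  rintro rfl
  exact (abs_one.not_lt hb)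

theorem zpow_neg_two_mul_pow_ne_one (hq0 : 0 < q) (hq1 : q < 1) (ht : 1 < |t|) (n : ℕ) :
    t ^ (-2 : ℤ) * (q ^ 2) ^ n ≠ 1 :=
  mul_pow_ne_one (abs_sq_lt_one hq0 hq1)
    (by simpa using abs_sq_mul_zpow_neg_two_lt_one one_pos ht) n

theorem zpow_two_mul (q : ℝ) (k : ℤ) : q ^ (2 * k) = (q ^ 2) ^ k := by
  rw [zpow_mul]
  rfl

theorem zpow_two_mul_add_two (hq : q ≠ 0) (k : ℤ) : q ^ (2 * k + 2) = q ^ (2 * k) * q ^ 2 := by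
  rw [zpow_add₀ hq]
  rfl

theorem series_add_one (hq : q ≠ 0) (k : ℤ) (x s : ℝ) :
    series q (k + 1) x s = phi11 (-(x * s)⁻¹) (q ^ 2 * s ^ (-2 : ℤ)) (q ^ 2)
      (q ^ 2 * (x * q ^ (2 * k + 2) * s⁻¹)) := by
  rw [series, zpow_two_mul_add_two hq (k + 1), mul_add_one]
  ring_nf

theorem series_sub_series_add_one (hq0 : 0 < q) (hq1 : q < 1) (hx : x ≠ 0) (ht : q < |t|)
    (k : ℤ) :
    series q k x t - series q (k + 1) x t =
      -(t ^ (-2 : ℤ) * q ^ (2 * k + 2) * ((1 + x * t) / (1 - q ^ 2 * t ^ (-2 : ℤ)))) *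
        series q (k + 1) (x * q⁻¹) (t * q⁻¹) := by
  have ht0 : t ≠ 0 := abs_pos.1 (hq0.trans ht)
  have hb : q ^ 2 * t ^ (-2 : ℤ) ≠ 1 := ne_of_abs_lt_one (abs_sq_mul_zpow_neg_two_lt_one hq0 ht)
  have e : series q (k + 1) (x * q⁻¹) (t * q⁻¹) = phi11 (-(x * t)⁻¹ * q ^ 2)
      (q ^ 2 * t ^ (-2 : ℤ) * q ^ 2) (q ^ 2) (q ^ 2 * (x * q ^ (2 * k + 2) * t⁻¹)) := by
    rw [series_add_one hq0.ne']
    congr 1 <;> field_simp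
  have ec : x * q ^ (2 * k + 2) * t⁻¹ * (1 - -(x * t)⁻¹) =
      t ^ (-2 : ℤ) * q ^ (2 * k + 2) * (1 + x * t) := by
    field_simp
    ring
  have h := phi11_sub_arg_mul (abs_sq_lt_one hq0 hq1) hb (-(x * t)⁻¹) (x * q ^ (2 * k + 2) * t⁻¹)
  rw [← e, ← series_add_one hq0.ne', ← series, neg_mul, ec] at h
  rw [eq_div_of_mul_eq (sub_ne_zero.2 hb.symm) ((mul_comm _ _).trans h)]
  ring

theorem series_sub_mul_series_add_one (hq0 : 0 < q) (hq1 : q < 1) (ht : 1 < |t|) (k : ℤ) :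
    series q k x t - t ^ (-2 : ℤ) * series q (k + 1) x t =
      (1 - t ^ (-2 : ℤ)) * series q (k + 1) (x * q⁻¹) (t * q) := by
  have ht0 : t ≠ 0 := abs_pos.1 (one_pos.trans ht)
  have e : series q (k + 1) (x * q⁻¹) (t * q) = phi11 (-(x * t)⁻¹) (t ^ (-2 : ℤ)) (q ^ 2)
      (x * q ^ (2 * k + 2) * t⁻¹) := by
    rw [series_add_one hq0.ne']
    congr 1 <;> field_simp
  rw [e, series_add_one hq0.ne', series, mul_comm (q ^ 2) (t ^ (-2 : ℤ)),
    phi11_of_bottom_mul (abs_sq_lt_one hq0 hq1) (zpow_neg_two_mul_pow_ne_one hq0 hq1 ht)]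

theorem series_sub_one_add_mul_series_add_one (hq0 : 0 < q) (hq1 : q < 1) (hx : x ≠ 0)
    (ht : q < |t|) (k : ℤ) :
    series q k x t - (1 + q ^ (2 * k)) * series q (k + 1) x t =
      -(q ^ (2 * k) * ((1 + q ^ 2 * x * t⁻¹) / (1 - q ^ 2 * t ^ (-2 : ℤ)))) *
        series q k (x * q) (t * q⁻¹) := by
  have ht0 : t ≠ 0 := abs_pos.1 (hq0.trans ht)
  have hQ := abs_sq_lt_one hq0 hq1
  have hB := abs_sq_mul_zpow_neg_two_lt_one hq0 ht
  have e : series q k (x * q) (t * q⁻¹) = phi11 (-(x * t)⁻¹)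
      (q ^ 2 * t ^ (-2 : ℤ) * q ^ 2) (q ^ 2) (q ^ 2 * (x * q ^ (2 * k + 2) * t⁻¹)) := by
    rw [series]
    congr 1 <;> field_simp
  have h := phi11_bottom_mul_arg_mul hQ (mul_pow_ne_one hQ hB) (-(x * t)⁻¹)
    (x * q ^ (2 * k + 2) * t⁻¹)
  rw [← e, ← series_add_one hq0.ne', ← series, zpow_two_mul_add_two hq0.ne'] at h
  have h' : (series q k x t - (1 + q ^ (2 * k)) * series q (k + 1) x t) *
      (1 - q ^ 2 * t ^ (-2 : ℤ)) =
      -q ^ (2 * k) * (1 + q ^ 2 * x * t⁻¹) * series q k (x * q) (t * q⁻¹) := by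
    field_simp at h ⊢
    linear_combination -h
  rw [eq_div_of_mul_eq (sub_ne_zero.2 (ne_of_abs_lt_one hB).symm) h']
  ring

theorem series_sub_mul_one_add_mul_series_add_one (hq0 : 0 < q) (hq1 : q < 1) (hx : x ≠ 0)
    (ht : 1 < |t|) (k : ℤ) :
    series q k x t - t ^ (-2 : ℤ) * (1 + q ^ (2 * k)) * series q (k + 1) x t =
      (1 - t ^ (-2 : ℤ)) * series q k (x * q) (t * q) := by
  have ht0 : t ≠ 0 := abs_pos.1 (one_pos.trans ht)
  have e : series q k (x * q) (t * q) = phi11 (-(x * t)⁻¹ * (q ^ 2)⁻¹) (t ^ (-2 : ℤ)) (q ^ 2)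
      (x * q ^ (2 * k + 2) * t⁻¹) := by
    rw [series]
    congr 1 <;> field_simp
  have ec : t ^ (-2 : ℤ) * (1 + q ^ (2 * k)) =
      t ^ (-2 : ℤ) - x * q ^ (2 * k + 2) * t⁻¹ * (-(x * t)⁻¹ * (q ^ 2)⁻¹) := by
    rw [zpow_two_mul_add_two hq0.ne']
    field_simp
    ring
  have h := phi11_of_top_bottom_mul (abs_sq_lt_one hq0 hq1)
    (zpow_neg_two_mul_pow_ne_one hq0 hq1 ht) (-(x * t)⁻¹ * (q ^ 2)⁻¹) (x * q ^ (2 * k + 2) * t⁻¹)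
  rwa [inv_mul_cancel_right₀ (by positivity), mul_comm (t ^ (-2 : ℤ)) (q ^ 2), ← e, ← ec,
    ← series_add_one hq0.ne', ← series] at h

theorem V_contiguous_alphaInf (hq0 : 0 < q) (hq1 : q < 1) (hx : x ≠ 0) (ht : q < |t|) (k : ℤ) :
    √(1 + q ^ (-2 * k)) * V q k x t + t * q ^ (-(k + 1)) * V q (k + 1) x t =
      t⁻¹ * ((1 + x * t) / (1 - q ^ 2 * t ^ (-2 : ℤ))) *
        V q (k + 1) (x * q⁻¹) (t * q⁻¹) := by
  have ht0 : t ≠ 0 := abs_pos.1 (hq0.trans ht)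
  have h := series_sub_series_add_one hq0 hq1 hx ht k
  have e : q ^ (2 * k + 2) = q ^ (k + 1) * q ^ (k + 1) := by
    rw [← zpow_add₀ hq0.ne']
    ring_nf
  rw [e] at h
  simp only [V_eq_amplitude_mul_series, amplitude_mul, amplitude_add_one hq0 hq1 ht0, inv_zpow',
    neg_neg, zpow_neg q (k + 1)]
  generalize (1 + x * t) / (1 - q ^ 2 * t ^ (-2 : ℤ)) = r at h ⊢
  generalize √(1 + q ^ (-2 * k)) = ρ
  field_simp at h ⊢
  linear_combination ρ * amplitude q k t * h

theorem V_contiguous_betaInf (hq0 : 0 < q) (hq1 : q < 1) (ht : 1 < |t|) (k : ℤ) :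
    t * √(1 + q ^ (-2 * k)) * V q k x t + q ^ (-(k + 1)) * V q (k + 1) x t =
      -t ^ 2 * (1 - t ^ (-2 : ℤ)) * V q (k + 1) (x * q⁻¹) (t * q) := by
  have ht0 : t ≠ 0 := abs_pos.1 (one_pos.trans ht)
  have h := series_sub_mul_series_add_one (x := x) hq0 hq1 ht k
  simp only [V_eq_amplitude_mul_series, amplitude_mul, amplitude_add_one hq0 hq1 ht0,
    zpow_neg q (k + 1)]
  generalize √(1 + q ^ (-2 * k)) = ρ
  field_simp at h ⊢
  linear_combination ρ * amplitude q k t * h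

theorem sqrt_mul_amplitude_add_one (hq0 : 0 < q) (hq1 : q < 1) (hs : s ≠ 0) (k : ℤ) :
    √(1 + q ^ (-2 * k)) * amplitude q (k + 1) s =
      -(q * q ^ (-k) * (1 + q ^ (2 * k)) * s⁻¹) * amplitude q k s := by
  have hsq : √(1 + q ^ (-2 * k)) * √(1 + q ^ (-2 * k)) = 1 + (q ^ (2 * k))⁻¹ := by
    rw [Real.mul_self_sqrt (by positivity), neg_mul, zpow_neg]
  have e : q ^ (2 * k) = q ^ k * q ^ k := by
    rw [two_mul, zpow_add₀ hq0.ne']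
  rw [amplitude_add_one hq0 hq1 hs, zpow_add_one₀ hq0.ne', zpow_neg]
  rw [e] at hsq ⊢
  linear_combination -(q ^ k * q * s⁻¹ * amplitude q k s) * hsq +
    q * s⁻¹ * amplitude q k s * (q ^ k - (q ^ k)⁻¹) * mul_inv_cancel₀ (zpow_ne_zero k hq0.ne')

theorem V_contiguous_gammaInf (hq0 : 0 < q) (hq1 : q < 1) (hx : x ≠ 0) (ht : q < |t|) (k : ℤ) :
    q ^ (-k) * V q k x t + q⁻¹ * t * √(1 + q ^ (-2 * k)) * V q (k + 1) x t =
      -((1 + q ^ 2 * x * t⁻¹) / (1 - q ^ 2 * t ^ (-2 : ℤ))) * V q k (x * q) (t * q⁻¹) := by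
  have ht0 : t ≠ 0 := abs_pos.1 (hq0.trans ht)
  have h := series_sub_one_add_mul_series_add_one hq0 hq1 hx ht k
  have hA := sqrt_mul_amplitude_add_one hq0 hq1 ht0 k
  have e : q ^ (2 * k) = q ^ k * q ^ k := by
    rw [two_mul, zpow_add₀ hq0.ne']
  simp only [V_eq_amplitude_mul_series, amplitude_mul, inv_zpow', neg_neg, zpow_neg q k, e]
    at h hA ⊢
  generalize (1 + q ^ 2 * x * t⁻¹) / (1 - q ^ 2 * t ^ (-2 : ℤ)) = r at h ⊢
  generalize √(1 + q ^ (-2 * k)) = ρ at hA ⊢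
  field_simp at h hA ⊢
  linear_combination q * amplitude q k t * h + series q (k + 1) x t * hA

theorem V_contiguous_deltaInf (hq0 : 0 < q) (hq1 : q < 1) (hx : x ≠ 0) (ht : 1 < |t|) (k : ℤ) :
    t * q ^ (-k) * V q k x t + q⁻¹ * √(1 + q ^ (-2 * k)) * V q (k + 1) x t =
      t * (1 - t ^ (-2 : ℤ)) * V q k (x * q) (t * q) := by
  have ht0 : t ≠ 0 := abs_pos.1 (one_pos.trans ht)
  have h := series_sub_mul_one_add_mul_series_add_one hq0 hq1 hx ht k
  have hA := sqrt_mul_amplitude_add_one hq0 hq1 ht0 k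
  simp only [V_eq_amplitude_mul_series, amplitude_mul]
  generalize √(1 + q ^ (-2 * k)) = ρ at hA ⊢
  field_simp at h hA ⊢
  linear_combination q * q ^ (-k) * amplitude q k t * h + series q (k + 1) x t * hA

end Vfunction

section SquareSummability

variable {q s t x ρ : ℝ}

theorem amplitude_add_one_sq (hq0 : 0 < q) (hq1 : q < 1) (hs : s ≠ 0) (k : ℤ) :
    amplitude q (k + 1) s ^ 2 = (1 + (q ^ 2) ^ k) * (q ^ 2 / s ^ 2) * amplitude q k s ^ 2 := by
  have h := sqrt_mul_amplitude_add_one hq0 hq1 hs k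
  have hk : q ^ k ≠ 0 := zpow_ne_zero k hq0.ne'
  rw [pow_two (amplitude q (k + 1) s)]
  nth_rw 1 [amplitude_add_one hq0 hq1 hs]
  rw [zpow_two_mul, zpow_neg] at h
  rw [zpow_add_one₀ hq0.ne']
  generalize √(1 + q ^ (-2 * k)) = ρ at h ⊢
  field_simp at h ⊢
  linear_combination -amplitude q k s * h

theorem summable_amplitude_sq_mul_zpow (hq0 : 0 < q) (hq1 : q < 1) (hs : s ≠ 0) (hρ : 0 < ρ)
    (hρs : q ^ 2 * ρ < s ^ 2) : Summable fun k : ℤ => amplitude q k s ^ 2 * ρ ^ k := by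
  have hQ0 : 0 < q ^ 2 := by positivity
  have hQ1 : q ^ 2 < 1 := pow_lt_one₀ hq0.le hq1 two_ne_zero
  set r := q ^ 2 * ρ / s ^ 2 with hr
  have hr0 : 0 < r := by positivity
  refine summable_int_of_ratio_tendsto (g := fun k => (1 + (q ^ 2) ^ k) * r) (l := r)
    (fun k => ?_) ?_ ?_ ?_
  · rw [amplitude_add_one_sq hq0 hq1 hs, zpow_add_one₀ hρ.ne', hr]
    ring
  · simpa using ((tendsto_pow_atTop_nhds_zero_of_lt_one hQ0.le hQ1).const_add 1).mul_const r
  · rw [Real.norm_of_nonneg hr0.le]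
    exact (div_lt_one (by positivity)).2 hρs
  · refine tendsto_atTop_mono (fun n => ?_)
      ((tendsto_pow_atTop_atTop_of_one_lt ((one_lt_inv₀ hQ0).2 hQ1)).atTop_mul_const hr0)
    rw [Real.norm_of_nonneg (by positivity), zpow_neg, zpow_natCast, inv_pow]
    gcongr
    linarith

theorem summable_V_sq_mul_zpow (hq0 : 0 < q) (hq1 : q < 1) (hs : s ≠ 0) (hρ : 0 < ρ)
    (hρs : q ^ 2 * ρ < s ^ 2) (hx : PolyGrowth (q ^ 2) fun k => series q k x s) :
    Summable fun k : ℤ => V q k x s ^ 2 * ρ ^ k := by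
  have hQ0 : 0 < q ^ 2 := by positivity
  have hQ1 : q ^ 2 < 1 := pow_lt_one₀ hq0.le hq1 two_ne_zero
  obtain ⟨N, hN⟩ := hx.mul hx
  have hsum (i : ℕ) : Summable fun k : ℤ => amplitude q k s ^ 2 * ((q ^ 2) ^ i * ρ) ^ k := by
    refine summable_amplitude_sq_mul_zpow hq0 hq1 hs (by positivity) (lt_of_le_of_lt ?_ hρs)
    gcongr
    exact mul_le_of_le_one_left hρ.le (pow_le_one₀ hQ0.le hQ1.le)
  have hmajor : Summable fun k : ℤ => amplitude q k s ^ 2 * ρ ^ k * (1 + (q ^ 2) ^ k) ^ N := by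
    refine (summable_sum fun i (_ : i ∈ Finset.range (N + 1)) =>
      (hsum i).mul_right (N.choose i : ℝ)).congr fun k => ?_
    rw [add_comm (1 : ℝ), add_pow, Finset.mul_sum]
    refine Finset.sum_congr rfl fun i _ => ?_
    rw [one_pow, mul_one, mul_zpow, ← zpow_natCast (q ^ 2), zpow_comm, zpow_natCast]
    ring
  refine summable_of_isBigO hmajor (IsBigO.mono ?_ le_top)
  refine (((isBigO_refl (fun k => amplitude q k s ^ 2 * ρ ^ k) ⊤).mul hN)).congr_left fun k => ?_
  rw [V_eq_amplitude_mul_series]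
  ring

theorem polyGrowth_series_v (hq0 : 0 < q) (hq1 : q < 1) (hs : q < |s|) (p : ℕ) :
    PolyGrowth (q ^ 2) fun k => series q k (-q ^ (2 * (p : ℤ)) * s⁻¹) s := by
  have hs0 : s ≠ 0 := abs_pos.1 (hq0.trans hs)
  have hQ1 : q ^ 2 < 1 := pow_lt_one₀ hq0.le hq1 two_ne_zero
  have h := polyGrowth_phi11_inv_pow (by positivity) hQ1
    (mul_pow_ne_one (abs_sq_lt_one hq0 hq1) (abs_sq_mul_zpow_neg_two_lt_one hq0 hs)) p
    (-q ^ (2 * (p : ℤ)) * q ^ 2 * (s⁻¹ * s⁻¹))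
  convert h using 2 with k
  rw [series]
  congr 1
  · rw [zpow_two_mul, zpow_natCast]
    field_simp
  · rw [zpow_two_mul_add_two hq0.ne', zpow_two_mul q k]
    ring

theorem polyGrowth_series_w (hq0 : 0 < q) (hq1 : q < 1) (hs : q < |s|) (p : ℤ) :
    PolyGrowth (q ^ 2) fun k => series q k (q ^ (2 * p) * s) s := by
  have hs0 : s ≠ 0 := abs_pos.1 (hq0.trans hs)
  have hQ1 : q ^ 2 < 1 := pow_lt_one₀ hq0.le hq1 two_ne_zero
  have h := (polyGrowth_phi11_zpow (by positivity) hQ1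
    (mul_pow_ne_one (abs_sq_lt_one hq0 hq1) (abs_sq_mul_zpow_neg_two_lt_one hq0 hs))
    (a := -(q ^ (2 * p) * s * s)⁻¹) (neg_ne_zero.2 (by positivity))).comp_add (by positivity)
    (p + 1)
  convert h using 2 with k
  rw [series]
  congr 1
  rw [zpow_two_mul_add_two hq0.ne', zpow_two_mul, zpow_two_mul, zpow_add₀ (by positivity),
    zpow_add_one₀ (by positivity)]
  field_simp

theorem norm_coeffs (q θ x s : ℝ) (k : ℤ) : ‖coeffs q θ x s k‖ = |V q k x s| := by
  have e : Complex.I * k * θ = ((k * θ : ℝ) : ℂ) * Complex.I := by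
    push_cast
    ring
  rw [coeffs, norm_mul, e, Complex.norm_exp_ofReal_mul_I, one_mul, Complex.norm_real,
    Real.norm_eq_abs]

theorem memℓp_two_iff {c : ℤ → ℂ} : Memℓp c 2 ↔ Summable fun k => ‖c k‖ ^ 2 := by
  rw [memℓp_gen_iff (by simp)]
  simp

theorem ofCoeffs_apply {c : ℤ → ℂ} (h : Memℓp c 2) (k : ℤ) : ofCoeffs c k = c k := by
  rw [ofCoeffs, dif_pos h]

theorem memℓp_coeffs (hq0 : 0 < q) (hq1 : q < 1) (hs : q < |s|) (θ : ℝ)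
    (hx : PolyGrowth (q ^ 2) fun k => series q k x s) : Memℓp (coeffs q θ x s) 2 := by
  have hρs : q ^ 2 * 1 < s ^ 2 := by
    rw [mul_one]
    exact sq_lt_sq.2 (by rwa [abs_of_pos hq0])
  simpa only [memℓp_two_iff, norm_coeffs, sq_abs, one_zpow, mul_one] using
    summable_V_sq_mul_zpow hq0 hq1 (abs_pos.1 (hq0.trans hs)) one_pos hρs hx

theorem ofCoeffs_coeffs_mem_DQ (hq0 : 0 < q) (hq1 : q < 1) (ht : 1 < |t|) (θ : ℝ)
    (hx : PolyGrowth (q ^ 2) fun k => series q k x t) : ofCoeffs (coeffs q θ x t) ∈ DQ q := by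
  have hρt : q ^ 2 * (q ^ 2)⁻¹ < t ^ 2 := by
    rw [mul_inv_cancel₀ (by positivity), one_lt_sq_iff_one_lt_abs]
    exact ht
  refine (summable_V_sq_mul_zpow hq0 hq1 (abs_pos.1 (one_pos.trans ht)) (by positivity) hρt
    hx).congr fun k => ?_
  rw [ofCoeffs_apply (memℓp_coeffs hq0 hq1 (hq1.trans ht) θ hx), norm_coeffs, sq_abs, zpow_mul]
  rfl

theorem memℓp_coeffs_v (hq0 : 0 < q) (hq1 : q < 1) (hs : q < |s|) (θ : ℝ) (p : ℕ) :
    Memℓp (coeffs q θ (-q ^ (2 * (p : ℤ)) * s⁻¹) s) 2 :=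
  memℓp_coeffs hq0 hq1 hs θ (polyGrowth_series_v hq0 hq1 hs p)

theorem memℓp_coeffs_w (hq0 : 0 < q) (hq1 : q < 1) (hs : q < |s|) (θ : ℝ) (p : ℤ) :
    Memℓp (coeffs q θ (q ^ (2 * p) * s) s) 2 :=
  memℓp_coeffs hq0 hq1 hs θ (polyGrowth_series_w hq0 hq1 hs p)

theorem v_mem_DQ (hq0 : 0 < q) (hq1 : q < 1) (ht : 1 < |t|) (θ : ℝ) (p : ℕ) :
    v q θ p t ∈ DQ q :=
  ofCoeffs_coeffs_mem_DQ hq0 hq1 ht θ (polyGrowth_series_v hq0 hq1 (hq1.trans ht) p)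

theorem w_mem_DQ (hq0 : 0 < q) (hq1 : q < 1) (ht : 1 < |t|) (θ : ℝ) (p : ℤ) :
    w q θ p t ∈ DQ q :=
  ofCoeffs_coeffs_mem_DQ hq0 hq1 ht θ (polyGrowth_series_w hq0 hq1 (hq1.trans ht) p)

end SquareSummability

section TwoTermShift

/-- The operator `T` on `𝒟(ℤ)` is a two-term weighted shift `e_k ↦ A_k e_{k+d} + B_k e_k` whose
weights are `O(√(1 + q^{-2k}))`, which is the growth that `𝒟(Q)` can absorb. -/
structure IsTwoTermShift (q : ℝ) (d : ℤ) (A B : ℤ → ℂ) (T : Module.End ℂ DZ) : Prop where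
  apply_single : ∀ k, T (Finsupp.single k 1) = Finsupp.single (k + d) (A k) + Finsupp.single k (B k)
  isBigO_shift : A =O[⊤] fun k => √(1 + q ^ (-2 * k))
  isBigO_diag : B =O[⊤] fun k => √(1 + q ^ (-2 * k))

variable {q : ℝ} {d : ℤ} {A B : ℤ → ℂ} {T : Module.End ℂ DZ}

theorem memℓp_mul_of_mem_DQ (hA : A =O[⊤] fun k => √(1 + q ^ (-2 * k))) {c : L2Z}
    (hc : c ∈ DQ q) : Memℓp (fun k => A k * c k) 2 := by
  have hpos (k : ℤ) : 0 ≤ 1 + q ^ (-2 * k) :=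
    add_nonneg zero_le_one (Even.zpow_nonneg ⟨-k, by ring⟩ q)
  have hsum : Summable fun k => (√(1 + q ^ (-2 * k)) * ‖c k‖) ^ 2 :=
    ((memℓp_two_iff.1 (lp.memℓp c)).add hc).congr fun k => by
      rw [mul_pow, Real.sq_sqrt (hpos k)]
      ring
  rw [memℓp_two_iff]
  exact summable_of_isBigO hsum
    (((hA.mul (isBigO_refl (fun k => c k) ⊤).norm_right).norm_left.pow 2).mono le_top)

theorem incl_single (k : ℤ) (z : ℂ) : incl (Finsupp.single k z) = lp.single 2 k z := by
  rw [incl, Finsupp.linearCombination_single, basisVec, ← lp.single_smul, smul_eq_mul, mul_one]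

namespace IsTwoTermShift

theorem exists_hasSum (hT : IsTwoTermShift q d A B T) {c : L2Z} (hc : c ∈ DQ q) :
    ∃ y : L2Z, (∀ m, y m = A (m - d) * c (m - d) + B m * c m) ∧
      HasSum (fun k : ℤ => c k • incl (T (Finsupp.single k 1))) y := by
  have hA : Memℓp (fun m => A (m - d) * c (m - d)) 2 := by
    have h := memℓp_mul_of_mem_DQ hT.isBigO_shift hc
    rw [memℓp_two_iff] at h ⊢
    exact h.comp_injective (sub_left_injective (b := d))
  let yA : L2Z := ⟨_, hA⟩
  let yB : L2Z := ⟨_, memℓp_mul_of_mem_DQ hT.isBigO_diag hc⟩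
  refine ⟨yA + yB, fun m => rfl, ?_⟩
  have hsA := (Equiv.addRight d).hasSum_iff.2 (lp.hasSum_single ENNReal.ofNat_ne_top yA)
  refine (hsA.add (lp.hasSum_single ENNReal.ofNat_ne_top yB)).congr_fun fun k => ?_
  have hyA : yA (k + d) = c k * A k := by
    simp only [yA, add_sub_cancel_right, mul_comm]
  have hyB : yB k = c k * B k := mul_comm _ _
  rw [hT.apply_single, map_add, incl_single, incl_single, smul_add, ← lp.single_smul,
    ← lp.single_smul, smul_eq_mul, smul_eq_mul, ← hyA, ← hyB]
  rfl

theorem domain_extend (hT : IsTwoTermShift q d A B T) : (extend q T).domain = DQ q :=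
  le_antisymm (fun _ h => h.1) fun _ h =>
    ⟨h, let ⟨_, _, hs⟩ := hT.exists_hasSum h; hs.summable⟩

theorem mapsVec_extend (hT : IsTwoTermShift q d A B T) {c c' : ℤ → ℂ} {μ : ℂ}
    (hc : Memℓp c 2) (hcD : ofCoeffs c ∈ DQ q) (hc' : μ = 0 ∨ Memℓp c' 2)
    (h : ∀ m, A (m - d) * c (m - d) + B m * c m = μ * c' m) :
    MapsVec (extend q T) (ofCoeffs c) (μ • ofCoeffs c') := by
  obtain ⟨y, hy, hs⟩ := hT.exists_hasSum hcD
  refine ⟨⟨hcD, hs.summable⟩, hs.tsum_eq.trans (lp.ext (funext fun m => ?_))⟩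
  rw [hy, ofCoeffs_apply hc, ofCoeffs_apply hc, h, lp.coeFn_smul, Pi.smul_apply, smul_eq_mul]
  rcases hc' with rfl | hc'
  · rw [zero_mul, zero_mul]
  · rw [ofCoeffs_apply hc']

end IsTwoTermShift

theorem isBigO_const_mul_ofReal {f : ℤ → ℝ} (hf : ∀ k, f k ^ 2 ≤ 1 + q ^ (-2 * k)) (u : ℂ) :
    (fun k => u * (f k : ℂ)) =O[⊤] fun k => √(1 + q ^ (-2 * k)) := by
  refine (isBigO_of_le ⊤ fun k => ?_).const_mul_left u
  rw [Complex.norm_real, Real.norm_of_nonneg (Real.sqrt_nonneg _)]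
  exact Real.abs_le_sqrt (hf k)

theorem isBigO_const_mul_zpow_neg (q : ℝ) (u : ℂ) :
    (fun k : ℤ => u * (q : ℂ) ^ (-k)) =O[⊤] fun k => √(1 + q ^ (-2 * k)) := by
  simp only [← Complex.ofReal_zpow]
  refine isBigO_const_mul_ofReal (fun k => ?_) u
  rw [← zpow_natCast, ← zpow_mul, mul_comm]
  norm_num

theorem conj_exp_I_mul (θ : ℝ) :
    (starRingEnd ℂ) (Complex.exp (Complex.I * θ)) = Complex.exp (-(Complex.I * θ)) := by
  rw [← Complex.exp_conj, map_mul, Complex.conj_I, Complex.conj_ofReal, neg_mul]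

theorem isTwoTermShift_rep_a_add_b (hq : 0 < q) (θ : ℝ) (u w : ℂ) :
    IsTwoTermShift q 1 (fun k => u * (√(1 + q ^ (-2 * k)) : ℝ))
      (fun k => w * q * Complex.exp (-(Complex.I * θ)) * (q : ℂ) ^ (-k))
      (rep hq (Complex.exp (Complex.I * θ)) (u • gen q Gen.a + w • gen q Gen.b)) where
  apply_single k := by
    simp only [map_add, map_smul, rep_gen, genAct, LinearMap.add_apply, LinearMap.smul_apply,
      Finsupp.linearCombination_single, one_smul, Finsupp.smul_single, smul_eq_mul,
      Complex.norm_exp_I_mul_ofReal, one_pow, one_mul, conj_exp_I_mul, mul_assoc]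
  isBigO_shift := isBigO_const_mul_ofReal (fun k => (Real.sq_sqrt (by positivity)).le) u
  isBigO_diag := isBigO_const_mul_zpow_neg q _

theorem isTwoTermShift_rep_c_add_d (hq : 0 < q) (hq1 : q < 1) (θ : ℝ) (u w : ℂ) :
    IsTwoTermShift q (-1) (fun k => w * (√(1 + q ^ (2 - 2 * k)) : ℝ))
      (fun k => u * Complex.exp (Complex.I * θ) * (q : ℂ) ^ (-k))
      (rep hq (Complex.exp (Complex.I * θ)) (u • gen q Gen.c + w • gen q Gen.d)) where
  apply_single k := by
    simp only [map_add, map_smul, rep_gen, genAct, LinearMap.add_apply, LinearMap.smul_apply,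
      Finsupp.linearCombination_single, one_smul, Finsupp.smul_single, smul_eq_mul,
      Complex.norm_exp_I_mul_ofReal, one_pow, one_mul, mul_assoc, ← sub_eq_add_neg]
    rw [add_comm]
  isBigO_shift := by
    refine isBigO_const_mul_ofReal (fun k => ?_) w
    rw [Real.sq_sqrt (by positivity)]
    gcongr 1 + ?_
    exact zpow_le_zpow_right_of_le_one₀ hq hq1.le (by linarith)
  isBigO_diag := isBigO_const_mul_zpow_neg q _

end TwoTermShift

section Action

variable {q t s x x' r θ u w : ℝ} {μ : ℂ}

theorem coeffs_add_int (q θ x t : ℝ) (m d : ℤ) : coeffs q θ x t (m + d) =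
    Complex.exp (Complex.I * m * θ) * Complex.exp (Complex.I * d * θ) * (V q (m + d) x t : ℂ) := by
  rw [coeffs, ← Complex.exp_add, Int.cast_add]
  ring_nf

theorem mapsVec_a_add_b (hq0 : 0 < q) (hq1 : q < 1) (ht : 1 < |t|)
    (hx : PolyGrowth (q ^ 2) fun k => series q k x t)
    (hx' : μ = 0 ∨ Memℓp (coeffs q θ x' s) 2)
    (h : ∀ k : ℤ, u * √(1 + q ^ (-2 * k)) * V q k x t + w * q * q ^ (-(k + 1)) * V q (k + 1) x t =
      r * V q (k + 1) x' s)
    (hμ : μ = Complex.exp (-(Complex.I * θ)) * (r : ℂ)) :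
    MapsVec (piOp hq0 θ ((u : ℂ) • gen q Gen.a + (w : ℂ) • gen q Gen.b))
      (ofCoeffs (coeffs q θ x t))
      (μ • ofCoeffs (coeffs q θ x' s)) := by
  refine (isTwoTermShift_rep_a_add_b hq0 θ u w).mapsVec_extend
    (memℓp_coeffs hq0 hq1 (hq1.trans ht) θ hx) (ofCoeffs_coeffs_mem_DQ hq0 hq1 ht θ hx)
    hx' fun m => ?_
  have e := congrArg (fun y : ℝ => (y : ℂ)) (h (m - 1))
  rw [sub_add_cancel] at e
  push_cast at e
  rw [sub_eq_add_neg, coeffs_add_int, coeffs, coeffs, ← sub_eq_add_neg]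
  have e' : Complex.exp (Complex.I * (-1 : ℤ) * θ) = Complex.exp (-(Complex.I * θ)) := by
    simp
  rw [e']
  rw [hμ]
  linear_combination
    (Complex.exp (Complex.I * m * θ) * Complex.exp (-(Complex.I * θ))) * e

theorem mapsVec_c_add_d (hq0 : 0 < q) (hq1 : q < 1) (ht : 1 < |t|)
    (hx : PolyGrowth (q ^ 2) fun k => series q k x t) (hx' : Memℓp (coeffs q θ x' s) 2)
    (h : ∀ k : ℤ, u * q ^ (-k) * V q k x t + w * √(1 + q ^ (-2 * k)) * V q (k + 1) x t =
      r * V q k x' s)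
    (hμ : μ = Complex.exp (Complex.I * θ) * (r : ℂ)) :
    MapsVec (piOp hq0 θ ((u : ℂ) • gen q Gen.c + (w : ℂ) • gen q Gen.d))
      (ofCoeffs (coeffs q θ x t))
      (μ • ofCoeffs (coeffs q θ x' s)) := by
  refine (isTwoTermShift_rep_c_add_d hq0 hq1 θ u w).mapsVec_extend
    (memℓp_coeffs hq0 hq1 (hq1.trans ht) θ hx) (ofCoeffs_coeffs_mem_DQ hq0 hq1 ht θ hx)
    (Or.inr hx') fun m => ?_
  have e := congrArg (fun y : ℝ => (y : ℂ)) (h m)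
  push_cast at e
  rw [sub_neg_eq_add, show 2 - 2 * (m + 1) = -2 * m by ring, coeffs_add_int, coeffs, coeffs,
    Int.cast_one, mul_one]
  rw [hμ]
  linear_combination
    (Complex.exp (Complex.I * m * θ) * Complex.exp (Complex.I * θ)) * e

theorem rpow_neg_half (hq : 0 < q) : q ^ (-1 / 2 : ℝ) = q ^ (1 / 2 : ℝ) * q⁻¹ := by
  rw [← Real.rpow_neg_one q, ← Real.rpow_add hq]
  norm_num

theorem mapsVec_alphaInf (hq0 : 0 < q) (hq1 : q < 1) (ht : 1 < |t|) (hx0 : x ≠ 0)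
    (hx : PolyGrowth (q ^ 2) fun k => series q k x t) (hx' : x' = x * q⁻¹)
    (hr : r = (1 + x * t) / (1 - q ^ 2 * t ^ (-2 : ℤ)))
    (h : r = 0 ∨ Memℓp (coeffs q θ x' (t * q⁻¹)) 2) :
    MapsVec (piOp hq0 θ (alphaInf q t)) (ofCoeffs (coeffs q θ x t))
      (((q ^ (1 / 2 : ℝ) : ℝ) * Complex.exp (-(Complex.I * θ)) * (t : ℂ)⁻¹ * (r : ℝ) : ℂ) •
        ofCoeffs (coeffs q θ x' (t * q⁻¹))) := by
  refine mapsVec_a_add_b (r := q ^ (1 / 2 : ℝ) * t⁻¹ * r) hq0 hq1 ht hx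
    (h.imp_left fun h => by rw [h, Complex.ofReal_zero, mul_zero]) (fun k => ?_)
    (by push_cast; ring)
  rw [rpow_neg_half hq0, hx', hr]
  linear_combination q ^ (1 / 2 : ℝ) * V_contiguous_alphaInf hq0 hq1 hx0 (hq1.trans ht) k +
    q ^ (1 / 2 : ℝ) * t * q ^ (-(k + 1)) * V q (k + 1) x t * inv_mul_cancel₀ hq0.ne'

theorem mapsVec_betaInf (hq0 : 0 < q) (hq1 : q < 1) (ht : 1 < |t|)
    (hx : PolyGrowth (q ^ 2) fun k => series q k x t) (hx' : x' = x * q⁻¹)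
    (h : Memℓp (coeffs q θ x' (t * q)) 2) :
    MapsVec (piOp hq0 θ (betaInf q t)) (ofCoeffs (coeffs q θ x t))
      ((-(t : ℂ) ^ 2 * (q ^ (1 / 2 : ℝ) : ℝ) * Complex.exp (-(Complex.I * θ)) *
        (1 - t ^ (-2 : ℤ) : ℝ) : ℂ) • ofCoeffs (coeffs q θ x' (t * q))) := by
  refine mapsVec_a_add_b (r := -t ^ 2 * q ^ (1 / 2 : ℝ) * (1 - t ^ (-2 : ℤ))) hq0 hq1 ht hx
    (Or.inr h) (fun k => ?_) (by push_cast; ring)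
  rw [rpow_neg_half hq0, inv_mul_cancel_right₀ hq0.ne', hx']
  linear_combination q ^ (1 / 2 : ℝ) * V_contiguous_betaInf hq0 hq1 ht k

theorem mapsVec_gammaInf (hq0 : 0 < q) (hq1 : q < 1) (ht : 1 < |t|) (hx0 : x ≠ 0)
    (hx : PolyGrowth (q ^ 2) fun k => series q k x t) (hx' : x' = x * q)
    (hr : r = (1 + q ^ 2 * x * t⁻¹) / (1 - q ^ 2 * t ^ (-2 : ℤ)))
    (h : Memℓp (coeffs q θ x' (t * q⁻¹)) 2) :
    MapsVec (piOp hq0 θ (gammaInf q t)) (ofCoeffs (coeffs q θ x t))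
      ((-(q ^ (1 / 2 : ℝ) : ℝ) * Complex.exp (Complex.I * θ) * (r : ℝ) : ℂ) •
        ofCoeffs (coeffs q θ x' (t * q⁻¹))) := by
  refine mapsVec_c_add_d (r := -(q ^ (1 / 2 : ℝ) * r)) hq0 hq1 ht hx h (fun k => ?_)
    (by push_cast; ring)
  rw [rpow_neg_half hq0, hx', hr]
  linear_combination q ^ (1 / 2 : ℝ) * V_contiguous_gammaInf hq0 hq1 hx0 (hq1.trans ht) k

theorem mapsVec_deltaInf (hq0 : 0 < q) (hq1 : q < 1) (ht : 1 < |t|) (hx0 : x ≠ 0)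
    (hx : PolyGrowth (q ^ 2) fun k => series q k x t) (hx' : x' = x * q)
    (h : Memℓp (coeffs q θ x' (t * q)) 2) :
    MapsVec (piOp hq0 θ (deltaInf q t)) (ofCoeffs (coeffs q θ x t))
      ((Complex.exp (Complex.I * θ) * t * (q ^ (1 / 2 : ℝ) : ℝ) *
        (1 - t ^ (-2 : ℤ) : ℝ) : ℂ) • ofCoeffs (coeffs q θ x' (t * q))) := by
  refine mapsVec_c_add_d (r := t * q ^ (1 / 2 : ℝ) * (1 - t ^ (-2 : ℤ))) hq0 hq1 ht hx h
    (fun k => ?_) (by push_cast; ring)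
  rw [rpow_neg_half hq0, hx']
  linear_combination q ^ (1 / 2 : ℝ) * V_contiguous_deltaInf hq0 hq1 hx0 ht k

end Action

section SpectralVectors

variable {q t : ℝ}

theorem lt_abs_mul_self (hq0 : 0 < q) (ht : 1 < |t|) : q < |t * q| := by
  rw [abs_mul, abs_of_pos hq0]
  exact lt_mul_of_one_lt_left hq0 ht

theorem lt_abs_mul_inv (hq0 : 0 < q) (hq1 : q < 1) (ht : 1 < |t|) : q < |t * q⁻¹| := by
  rw [abs_mul, abs_of_pos (inv_pos.2 hq0), ← div_eq_mul_inv, lt_div_iff₀ hq0]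
  nlinarith

theorem neg_zpow_mul_inv_ne_zero (hq : q ≠ 0) (ht : t ≠ 0) (n : ℤ) : -q ^ n * t⁻¹ ≠ 0 :=
  mul_ne_zero (neg_ne_zero.2 (zpow_ne_zero n hq)) (inv_ne_zero ht)

theorem zpow_two_mul_sub_one (hq : q ≠ 0) (p : ℤ) :
    q ^ (2 * (p - 1)) = q ^ (2 * p) * q⁻¹ * q⁻¹ := by
  rw [← zpow_sub_one₀ hq, ← zpow_sub_one₀ hq]
  ring_nf

theorem zpow_two_mul_add_one (hq : q ≠ 0) (p : ℤ) :
    q ^ (2 * (p + 1)) = q ^ (2 * p) * q * q := by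
  rw [← zpow_add_one₀ hq, ← zpow_add_one₀ hq]
  ring_nf

theorem mapsVec_alphaInf_v (hq0 : 0 < q) (hq1 : q < 1) (ht : 1 < |t|) (θ : ℝ) (p : ℕ) :
    MapsVec (piOp hq0 θ (alphaInf q t)) (v q θ p t)
      (((q ^ (1 / 2 : ℝ) : ℝ) * Complex.exp (-(Complex.I * θ)) * (t : ℂ)⁻¹ *
        ((1 - q ^ (2 * p)) / (1 - q ^ 2 * t ^ (-2 : ℤ)) : ℝ) : ℂ) •
          v q θ ((p : ℤ) - 1) (t * q⁻¹)) := by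
  have ht0 : t ≠ 0 := abs_pos.1 (one_pos.trans ht)
  refine mapsVec_alphaInf hq0 hq1 ht (neg_zpow_mul_inv_ne_zero hq0.ne' ht0 _)
    (polyGrowth_series_v hq0 hq1 (hq1.trans ht) p) ?_ ?_ ?_
  · rw [zpow_two_mul_sub_one hq0.ne']
    field_simp
  · rw [inv_mul_cancel_right₀ ht0, ← sub_eq_add_neg]
    norm_cast
  · rcases p with - | p
    · exact Or.inl (by simp)
    · rw [Nat.cast_succ, add_sub_cancel_right]
      exact Or.inr (memℓp_coeffs_v hq0 hq1 (lt_abs_mul_inv hq0 hq1 ht) θ p)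

theorem mapsVec_alphaInf_w (hq0 : 0 < q) (hq1 : q < 1) (ht : 1 < |t|) (θ : ℝ) (p : ℤ) :
    MapsVec (piOp hq0 θ (alphaInf q t)) (w q θ p t)
      (((q ^ (1 / 2 : ℝ) : ℝ) * Complex.exp (-(Complex.I * θ)) * (t : ℂ)⁻¹ *
        ((1 + t ^ 2 * q ^ (2 * p)) / (1 - q ^ 2 * t ^ (-2 : ℤ)) : ℝ) : ℂ) •
          w q θ p (t * q⁻¹)) :=
  mapsVec_alphaInf hq0 hq1 ht (mul_ne_zero (zpow_ne_zero _ hq0.ne') (abs_pos.1 (one_pos.trans ht)))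
    (polyGrowth_series_w hq0 hq1 (hq1.trans ht) p) (mul_assoc _ _ _).symm (by ring)
    (Or.inr (memℓp_coeffs_w hq0 hq1 (lt_abs_mul_inv hq0 hq1 ht) θ p))

theorem mapsVec_betaInf_v (hq0 : 0 < q) (hq1 : q < 1) (ht : 1 < |t|) (θ : ℝ) (p : ℕ) :
    MapsVec (piOp hq0 θ (betaInf q t)) (v q θ p t)
      ((-(t : ℂ) ^ 2 * (q ^ (1 / 2 : ℝ) : ℝ) * Complex.exp (-(Complex.I * θ)) *
        (1 - t ^ (-2 : ℤ) : ℝ) : ℂ) • v q θ p (t * q)) :=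
  mapsVec_betaInf hq0 hq1 ht (polyGrowth_series_v hq0 hq1 (hq1.trans ht) p)
    (by rw [mul_inv, mul_assoc]) (memℓp_coeffs_v hq0 hq1 (lt_abs_mul_self hq0 ht) θ p)

theorem mapsVec_betaInf_w (hq0 : 0 < q) (hq1 : q < 1) (ht : 1 < |t|) (θ : ℝ) (p : ℤ) :
    MapsVec (piOp hq0 θ (betaInf q t)) (w q θ p t)
      ((-(t : ℂ) ^ 2 * (q ^ (1 / 2 : ℝ) : ℝ) * Complex.exp (-(Complex.I * θ)) *
        (1 - t ^ (-2 : ℤ) : ℝ) : ℂ) • w q θ (p - 1) (t * q)) := by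
  refine mapsVec_betaInf hq0 hq1 ht (polyGrowth_series_w hq0 hq1 (hq1.trans ht) p) ?_
    (memℓp_coeffs_w hq0 hq1 (lt_abs_mul_self hq0 ht) θ (p - 1))
  rw [zpow_two_mul_sub_one hq0.ne']
  field_simp

theorem mapsVec_gammaInf_v (hq0 : 0 < q) (hq1 : q < 1) (ht : 1 < |t|) (θ : ℝ) (p : ℕ) :
    MapsVec (piOp hq0 θ (gammaInf q t)) (v q θ p t)
      ((-(q ^ (1 / 2 : ℝ) : ℝ) * Complex.exp (Complex.I * θ) *
        ((1 - q ^ (2 + 2 * p) * t ^ (-2 : ℤ)) / (1 - q ^ 2 * t ^ (-2 : ℤ)) : ℝ) : ℂ) •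
          v q θ p (t * q⁻¹)) := by
  have ht0 : t ≠ 0 := abs_pos.1 (one_pos.trans ht)
  refine mapsVec_gammaInf hq0 hq1 ht (neg_zpow_mul_inv_ne_zero hq0.ne' ht0 _)
    (polyGrowth_series_v hq0 hq1 (hq1.trans ht) p) ?_ ?_
    (memℓp_coeffs_v hq0 hq1 (lt_abs_mul_inv hq0 hq1 ht) θ p)
  · rw [mul_inv, inv_inv, mul_assoc]
  · rw [pow_add, zpow_neg]
    norm_cast
    field_simp
    ring

theorem mapsVec_gammaInf_w (hq0 : 0 < q) (hq1 : q < 1) (ht : 1 < |t|) (θ : ℝ) (p : ℤ) :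
    MapsVec (piOp hq0 θ (gammaInf q t)) (w q θ p t)
      ((-(q ^ (1 / 2 : ℝ) : ℝ) * Complex.exp (Complex.I * θ) *
        ((1 + q ^ (2 + 2 * p)) / (1 - q ^ 2 * t ^ (-2 : ℤ)) : ℝ) : ℂ) •
          w q θ (p + 1) (t * q⁻¹)) := by
  have ht0 : t ≠ 0 := abs_pos.1 (one_pos.trans ht)
  refine mapsVec_gammaInf hq0 hq1 ht (mul_ne_zero (zpow_ne_zero _ hq0.ne') ht0)
    (polyGrowth_series_w hq0 hq1 (hq1.trans ht) p) ?_ ?_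
    (memℓp_coeffs_w hq0 hq1 (lt_abs_mul_inv hq0 hq1 ht) θ (p + 1))
  · rw [zpow_two_mul_add_one hq0.ne']
    field_simp
  · rw [zpow_add₀ hq0.ne', ← mul_assoc, mul_inv_cancel_right₀ ht0]
    norm_cast

theorem mapsVec_deltaInf_v (hq0 : 0 < q) (hq1 : q < 1) (ht : 1 < |t|) (θ : ℝ) (p : ℕ) :
    MapsVec (piOp hq0 θ (deltaInf q t)) (v q θ p t)
      ((Complex.exp (Complex.I * θ) * t * (q ^ (1 / 2 : ℝ) : ℝ) *
        (1 - t ^ (-2 : ℤ) : ℝ) : ℂ) • v q θ ((p : ℤ) + 1) (t * q)) := by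
  have ht0 : t ≠ 0 := abs_pos.1 (one_pos.trans ht)
  refine mapsVec_deltaInf hq0 hq1 ht (neg_zpow_mul_inv_ne_zero hq0.ne' ht0 _)
    (polyGrowth_series_v hq0 hq1 (hq1.trans ht) p) ?_ ?_
  · rw [zpow_two_mul_add_one hq0.ne']
    field_simp
  · exact_mod_cast memℓp_coeffs_v hq0 hq1 (lt_abs_mul_self hq0 ht) θ (p + 1)

theorem mapsVec_deltaInf_w (hq0 : 0 < q) (hq1 : q < 1) (ht : 1 < |t|) (θ : ℝ) (p : ℤ) :
    MapsVec (piOp hq0 θ (deltaInf q t)) (w q θ p t)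
      ((Complex.exp (Complex.I * θ) * t * (q ^ (1 / 2 : ℝ) : ℝ) *
        (1 - t ^ (-2 : ℤ) : ℝ) : ℂ) • w q θ p (t * q)) :=
  mapsVec_deltaInf hq0 hq1 ht (mul_ne_zero (zpow_ne_zero _ hq0.ne') (abs_pos.1 (one_pos.trans ht)))
    (polyGrowth_series_w hq0 hq1 (hq1.trans ht) p) (mul_assoc _ _ _).symm
    (memℓp_coeffs_w hq0 hq1 (lt_abs_mul_self hq0 ht) θ p)

end SpectralVectors

end QSU11

end

theorem proposition4p4 (q : ℝ) (hq : 0 < q) (hq1 : q < 1) (t : ℝ) (ht : 1 < |t|) (θ : ℝ) :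
    -- the sequences defining the vectors `v^θ_p(s)`, `w^θ_p(s)`, `|s| > q`, are square summable
    (∀ s : ℝ, q < |s| →
      (∀ p : ℕ, Memℓp (QSU11.coeffs q θ (-q ^ (2 * (p : ℤ)) * s⁻¹) s) 2) ∧
      (∀ p : ℤ, Memℓp (QSU11.coeffs q θ (q ^ (2 * p) * s) s) 2)) ∧
    -- the four operators are defined on `𝒟(Q)`
    (QSU11.piOp hq θ (QSU11.alphaInf q t)).domain = QSU11.DQ q ∧
    (QSU11.piOp hq θ (QSU11.betaInf q t)).domain = QSU11.DQ q ∧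
    (QSU11.piOp hq θ (QSU11.gammaInf q t)).domain = QSU11.DQ q ∧
    (QSU11.piOp hq θ (QSU11.deltaInf q t)).domain = QSU11.DQ q ∧
    -- the vectors lie in `𝒟(Q)`
    (∀ p : ℕ, QSU11.v q θ p t ∈ QSU11.DQ q) ∧
    (∀ p : ℤ, QSU11.w q θ p t ∈ QSU11.DQ q) ∧
    -- action of `α_{∞,t}`
    (∀ p : ℕ, QSU11.MapsVec (QSU11.piOp hq θ (QSU11.alphaInf q t)) (QSU11.v q θ p t)
      (((q ^ (1 / 2 : ℝ) : ℝ) * Complex.exp (-(Complex.I * θ)) * (t : ℂ)⁻¹ *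
        ((1 - q ^ (2 * p)) / (1 - q ^ 2 * t ^ (-2 : ℤ)) : ℝ) : ℂ) •
          QSU11.v q θ ((p : ℤ) - 1) (t * q⁻¹))) ∧
    (∀ p : ℤ, QSU11.MapsVec (QSU11.piOp hq θ (QSU11.alphaInf q t)) (QSU11.w q θ p t)
      (((q ^ (1 / 2 : ℝ) : ℝ) * Complex.exp (-(Complex.I * θ)) * (t : ℂ)⁻¹ *
        ((1 + t ^ 2 * q ^ (2 * p)) / (1 - q ^ 2 * t ^ (-2 : ℤ)) : ℝ) : ℂ) •
          QSU11.w q θ p (t * q⁻¹))) ∧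
    -- action of `β_{∞,t}`
    (∀ p : ℕ, QSU11.MapsVec (QSU11.piOp hq θ (QSU11.betaInf q t)) (QSU11.v q θ p t)
      ((-(t : ℂ) ^ 2 * (q ^ (1 / 2 : ℝ) : ℝ) * Complex.exp (-(Complex.I * θ)) *
        (1 - t ^ (-2 : ℤ) : ℝ) : ℂ) • QSU11.v q θ p (t * q))) ∧
    (∀ p : ℤ, QSU11.MapsVec (QSU11.piOp hq θ (QSU11.betaInf q t)) (QSU11.w q θ p t)
      ((-(t : ℂ) ^ 2 * (q ^ (1 / 2 : ℝ) : ℝ) * Complex.exp (-(Complex.I * θ)) *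
        (1 - t ^ (-2 : ℤ) : ℝ) : ℂ) • QSU11.w q θ (p - 1) (t * q))) ∧
    -- action of `γ_{∞,t}`
    (∀ p : ℕ, QSU11.MapsVec (QSU11.piOp hq θ (QSU11.gammaInf q t)) (QSU11.v q θ p t)
      ((-(q ^ (1 / 2 : ℝ) : ℝ) * Complex.exp (Complex.I * θ) *
        ((1 - q ^ (2 + 2 * p) * t ^ (-2 : ℤ)) / (1 - q ^ 2 * t ^ (-2 : ℤ)) : ℝ) : ℂ) •
          QSU11.v q θ p (t * q⁻¹))) ∧
    (∀ p : ℤ, QSU11.MapsVec (QSU11.piOp hq θ (QSU11.gammaInf q t)) (QSU11.w q θ p t)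
      ((-(q ^ (1 / 2 : ℝ) : ℝ) * Complex.exp (Complex.I * θ) *
        ((1 + q ^ (2 + 2 * p)) / (1 - q ^ 2 * t ^ (-2 : ℤ)) : ℝ) : ℂ) •
          QSU11.w q θ (p + 1) (t * q⁻¹))) ∧
    -- action of `δ_{∞,t}`
    (∀ p : ℕ, QSU11.MapsVec (QSU11.piOp hq θ (QSU11.deltaInf q t)) (QSU11.v q θ p t)
      ((Complex.exp (Complex.I * θ) * t * (q ^ (1 / 2 : ℝ) : ℝ) *
        (1 - t ^ (-2 : ℤ) : ℝ) : ℂ) • QSU11.v q θ ((p : ℤ) + 1) (t * q))) ∧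
    (∀ p : ℤ, QSU11.MapsVec (QSU11.piOp hq θ (QSU11.deltaInf q t)) (QSU11.w q θ p t)
      ((Complex.exp (Complex.I * θ) * t * (q ^ (1 / 2 : ℝ) : ℝ) *
        (1 - t ^ (-2 : ℤ) : ℝ) : ℂ) • QSU11.w q θ p (t * q))) :=
  ⟨fun _ hs => ⟨QSU11.memℓp_coeffs_v hq hq1 hs θ, QSU11.memℓp_coeffs_w hq hq1 hs θ⟩,
    (QSU11.isTwoTermShift_rep_a_add_b hq θ _ _).domain_extend,
    (QSU11.isTwoTermShift_rep_a_add_b hq θ _ _).domain_extend,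
    (QSU11.isTwoTermShift_rep_c_add_d hq hq1 θ _ _).domain_extend,
    (QSU11.isTwoTermShift_rep_c_add_d hq hq1 θ _ _).domain_extend,
    QSU11.v_mem_DQ hq hq1 ht θ, QSU11.w_mem_DQ hq hq1 ht θ,
    QSU11.mapsVec_alphaInf_v hq hq1 ht θ, QSU11.mapsVec_alphaInf_w hq hq1 ht θ,
    QSU11.mapsVec_betaInf_v hq hq1 ht θ, QSU11.mapsVec_betaInf_w hq hq1 ht θ,
    QSU11.mapsVec_gammaInf_v hq hq1 ht θ, QSU11.mapsVec_gammaInf_w hq hq1 ht θ,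
    QSU11.mapsVec_deltaInf_v hq hq1 ht θ, QSU11.mapsVec_deltaInf_w hq hq1 ht θ⟩
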